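/- For every $\epsilon\in(0,2]$ there is a constant $\delta=\delta(\epsilon)\in(0,1)$, depending only on $\epsilon$, with the following property. Let $n\in\mathbb N$ and let $\Gamma\subset\mathbb R^n$ be a simple closed regular $C^1$ curve whose total curvature (the supremum of the sums of the exterior angles of inscribed closed polygons) is at most $(4-\epsilon)\pi$. Let $M$ be a compact smooth surface with smooth boundary $\partial M$, and let $u:M\to\mathbb R^n$ be a branched immersion which is injective on $\partial M$ and satisfies $u(\partial M)=\Gamma$. Here a branched immersion is a $C^1$ map such that at every $q\in M$ (boundary points included) either $du_q$ has rank $2$, or $q$ is a branch point: for some integer $m\ge 2$, in a local coordinate $z$ of $M$ with values in $\mathbb C$ and centred at $q$, and up to a rigid motion of $\mathbb R^n\simeq\mathbb C\times\mathbb R^{n-2}$, one has $u=(z^m,f(z))$ near $q$, with $f(z)=o(|z|^m)$ as $z\to0$. Let $dA=\sqrt{\det(du^*du)}\,d\mathcal H^2$ be the area measure of $u$ on $M$. Suppose that $u$ has mean curvature vector $H$, that is, $H:M\to\mathbb R^n$ is an integrable vector field normal to $u$ with $\int_M \operatorname{div}_M X\,dA=\int_M X\cdot H\,dA$ for all $C^1$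 vector fields $X$ with compact support in $\mathbb R^n\setminus\Gamma$, and suppose that the divergence identity $$\int_M \operatorname{div}_M X\,dA=\int_M X\cdot H\,dA+\int_\Gamma X\cdot\nu_M\,d\mathcal H^1$$ holds for every $C^1$ vector field $X$ on $\mathbb R^n$, where $\nu_M$ is the outward unit conormal of $M$ along $\Gamma$. Let $p\in(2,\infty]$ and $H\in L^p(M)$, and let $r_0=\max_{x,y\in u(M)}|x-y|$. Put $C(p)=\frac{2p}{p-2}\left(\frac2\pi\right)^{1/p}$ and $\alpha=1-\frac2p$ if $p<\infty$, and $C(\infty)=1$, $\alpha=1$ if $p=\infty$. If $$C(p)\,\|H\|_{L^p(M)}\,r_0^{\alpha}<\delta,$$ then $M$ is embedded up to and including the boundary: $u$ is a homeomorphism onto its image, and $du_q$ has rank $2$ for every $q\in M$, boundary points included. -/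

import Mathlib

open scoped Manifold ContDiff ENNReal
open MeasureTheory

noncomputable section

namespace BranchedSurface

/-- The ambient Euclidean space `ℝⁿ`. -/
abbrev E (n : ℕ) : Type := EuclideanSpace ℝ (Fin n)

/-! ### Closed curves and total curvature -/

/-- `γ` is a (1-periodic, regular) parametrization of a simple closed `C¹` curve. -/
structure IsC1ClosedCurve {n : ℕ} (γ : ℝ → E n) : Prop where
  contDiff : ContDiff ℝ 1 γ
  periodic : Function.Periodic γ 1
  regular : ∀ t, deriv γ t ≠ 0
  simple : Set.InjOn γ (Set.Ico 0 1)

/-- The sum of the exterior angles of the closed polygon with vertices `v 0, …, v (k + 2)`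
(indices are cyclic). -/
def polygonCurvature {n k : ℕ} (v : Fin (k + 3) → E n) : ℝ :=
  ∑ i, InnerProductGeometry.angle (v (i + 1) - v i) (v (i + 2) - v (i + 1))

/-- Total curvature of a closed curve: the supremum of the total curvatures of the inscribed
closed polygons. -/
def totalCurvature {n : ℕ} (γ : ℝ → E n) : ℝ≥0∞ :=
  ⨆ (k : ℕ) (t : Fin (k + 3) → ℝ) (_ : StrictMono t) (_ : ∀ i, t i ∈ Set.Ico (0 : ℝ) 1),
    ENNReal.ofReal (polygonCurvature fun i => γ (t i))

/-! ### Maps of a surface with boundary into `ℝⁿ` -/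

section Surface

variable {n : ℕ} {M : Type*} [TopologicalSpace M] [ChartedSpace (EuclideanHalfSpace 2) M]

/-- The differential `du_q : T_q M → ℝⁿ`; the tangent space is identified with `ℝ²` through the
preferred chart at `q`, whose values lie in the half plane `{x | 0 ≤ x 0}`. -/
def du (u : M → E n) (q : M) : E 2 →L[ℝ] E n :=
  mfderiv (𝓡∂ 2) 𝓘(ℝ, E n) u q

/-- The image of the tangent plane at `q` in `ℝⁿ`. -/
def tangentPlane (u : M → E n) (q : M) : Submodule ℝ (E n) :=
  LinearMap.range (du u q).toLinearMap

/-- `u` has a branch point at `p`: for some `m ≥ 2`, up to a rigid motion of `ℝⁿ` and in a local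
coordinate `z` of `M` centred at `p`, one has `u = (z ^ m, f z) ∈ ℂ × ℝⁿ⁻²` with
`f z = o(|z| ^ m)`. The isometric embedding `P` is the inclusion of the factor `ℂ`, and `f` takes
values in its orthogonal complement. At a boundary point, `z` maps a neighbourhood of `p` onto a
one-sided neighbourhood of `0` in `ℂ`. -/
def IsBranchPoint (u : M → E n) (p : M) : Prop :=
  ∃ (m : ℕ) (z : M → ℂ) (P : ℂ →ₗᵢ[ℝ] E n) (f : ℂ → E n),
    2 ≤ m ∧
    ContMDiffAt (𝓡∂ 2) 𝓘(ℝ, ℂ) 1 z p ∧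
    z p = 0 ∧
    Function.Injective (mfderiv (𝓡∂ 2) 𝓘(ℝ, ℂ) z p) ∧
    (∀ w w', inner ℝ (P w) (f w') = 0) ∧
    Asymptotics.IsLittleO (nhds 0) f (fun w => ‖w‖ ^ m) ∧
    ∀ᶠ q in nhds p, u q = u p + P (z q ^ m) + f (z q)

/-- A branched immersion: a `C¹` map which at every point (boundary points included) either is an
immersion or has a branch point. -/
structure IsBranchedImmersion (u : M → E n) : Prop where
  contMDiff : ContMDiff (𝓡∂ 2) 𝓘(ℝ, E n) 1 u
  immersed_or_branch : ∀ p, Function.Injective (du u p) ∨ IsBranchPoint u p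

/-- `u` is an embedding of the surface, boundary included: an immersion at every point and a
homeomorphism onto its image. -/
structure IsEmbedded (u : M → E n) : Prop where
  isEmbedding : Topology.IsEmbedding u
  immersion : ∀ p, Function.Injective (du u p)

/-- The boundary curve `Γ = u(∂M)`. -/
def boundaryCurve (u : M → E n) : Set (E n) :=
  u '' (𝓡∂ 2).boundary M

/-! ### Area -/

/-- The Jacobian `√det(D* D)` of a linear map. -/
def jacobian (D : E 2 →L[ℝ] E n) : ℝ :=
  Real.sqrt (ContinuousLinearMap.det (ContinuousLinearMap.adjoint D ∘L D))

/-- The area of `u` inside the chart at `p`, as a measure on `M`: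
`A ↦ ∫_{φ(A)} J(u ∘ φ⁻¹) dx`, where `φ` is the chart at `p`. -/
def chartArea [MeasurableSpace M] (u : M → E n) (p : M) : Measure M :=
  ((volume.restrict (extChartAt (𝓡∂ 2) p).target).withDensity fun x =>
      ENNReal.ofReal (jacobian
        (fderivWithin ℝ (u ∘ (extChartAt (𝓡∂ 2) p).symm) (Set.range (𝓡∂ 2)) x))).map
    (extChartAt (𝓡∂ 2) p).symm

/-- The area measure `dA = Ju dℋ²` on `M`. The measures in the single charts agree on overlaps, so
their supremum is the measure on `M` that restricts to each of them. -/
def area [MeasurableSpace M] (u : M → E n) : Measure M :=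
  ⨆ p : M, chartArea u p

/-! ### Divergence, conormal, mean curvature -/

/-- The tangential divergence `div_M X` at `q`: the trace of `DX` over the tangent plane. -/
def tangentialDiv (u : M → E n) (X : E n → E n) (q : M) : ℝ :=
  LinearMap.trace ℝ (E n)
    ((tangentPlane u q).starProjection ∘L fderiv ℝ X (u q)).toLinearMap

/-- The outward unit conormal at a boundary point `q`: the outward vector `du(-e₀)` is made
orthogonal to the tangent `du(e₁)` of the boundary curve and normalized. -/
def conormal (u : M → E n) (q : M) : E n :=
  let w := (ℝ ∙ du u q (EuclideanSpace.single 1 1))ᗮ.starProjection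
    (-du u q (EuclideanSpace.single 0 1))
  ‖w‖⁻¹ • w

open Classical in
/-- The outward unit conormal `ν_M` as a function of the point `x = u q` of the boundary curve
(`u` is injective on the boundary). -/
def boundaryConormal (u : M → E n) (x : E n) : E n :=
  if h : ∃ q, q ∈ (𝓡∂ 2).boundary M ∧ u q = x then conormal u h.choose else 0

/-- `H` is the mean curvature vector of the branched immersion `u`. -/
structure IsMeanCurvature [MeasurableSpace M] (u : M → E n) (H : M → E n) : Prop where
  integrable : Integrable H (area u)
  normal : ∀ᵐ q ∂area u, H q ∈ (tangentPlane u q)ᗮ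
  firstVariation : ∀ X : E n → E n, ContDiff ℝ 1 X → HasCompactSupport X →
    tsupport X ⊆ (boundaryCurve u)ᶜ →
    ∫ q, tangentialDiv u X q ∂area u = ∫ q, inner ℝ (X (u q)) (H q) ∂area u

/-- The divergence identity up to the boundary. -/
def DivergenceIdentity [MeasurableSpace M] (u : M → E n) (H : M → E n) : Prop :=
  ∀ X : E n → E n, ContDiff ℝ 1 X →
    ∫ q, tangentialDiv u X q ∂area u =
      ∫ q, inner ℝ (X (u q)) (H q) ∂area u +
        ∫ x in boundaryCurve u, inner ℝ (X x) (boundaryConormal u x) ∂μH[1]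

end Surface

/-- The constant `C(p)`. -/
def constC (p : ℝ≥0∞) : ℝ :=
  if p = ⊤ then 1 else 2 * p.toReal / (p.toReal - 2) * (2 / Real.pi) ^ (1 / p.toReal)

/-- The exponent `α = 1 - 2/p`. -/
def expAlpha (p : ℝ≥0∞) : ℝ :=
  if p = ⊤ then 1 else 1 - 2 / p.toReal

end BranchedSurface

end

/-!
Testing the divergence identity with `X = (x - x₀) / (s² + |x - x₀|²)` gives, since
`div_M X = 2 s² / (s² + |x - x₀|²)² + 2 |X^⊥|²`,
`∫_M 2 s² / (s² + |u - x₀|²)² ≤ ∫_Γ X · ν + (1/8) ∫_M |H|²`.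
The boundary term is at most the regularized angle which `Γ` sweeps out as seen from `x₀`;
comparing with inscribed polygons, this angle is at most the total curvature, and at most the total
curvature minus `π` if `x₀ ∈ Γ`. So if `(1/8) ∫ |H|²` is small, the kernel integrals stay below
`4π`, and below `3π` at points of `Γ`. As `s → 0`, a preimage of `x₀` of order `m` contributes
`2πm` to the left-hand side if it is an interior point and `πm` if it is a boundary point. This
excludes double points that involve the interior, interior branch points, and boundary orders
`m ≥ 3`. Boundary points of order `2` do not occur because a simple regular `C¹` curve cannot turn
back.

The Willmore energy is small by Hölder's inequality, `∫ |H|² ≤ ‖H‖_p² A^α`, together with the bound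
on the area `A` which the same inequality gives at the scale `s = r₀`.
-/

noncomputable section

namespace BranchedSurface

open Filter Topology InnerProductGeometry

/-! ### Angles and wedge norms -/

section InnerProduct

variable {V : Type*} [NormedAddCommGroup V] [InnerProductSpace ℝ V]

lemma sum_angle_sub_le_sum_exterior_angle {k : ℕ} (v : Fin (k + 3) → V)
    (hv : ∀ i, v (i + 1) ≠ v i) (x : V) :
    ∑ i, angle (v i - x) (v (i + 1) - x) ≤
      ∑ i, angle (v (i + 1) - v i) (v (i + 2) - v (i + 1)) := by
  have angle_eq_sub (i) : angle (v i - x) (v (i + 1) - x) =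
      angle (v i - x) (v (i + 1) - v i) - angle (v (i + 1) - v i) (v (i + 1) - x) := by
    have := angle_eq_angle_add_add_angle_add (v i - x) (sub_ne_zero.2 (hv i))
    rw [show v i - x + (v (i + 1) - v i) = v (i + 1) - x by abel] at this
    linarith
  have sum_shift : ∑ i, angle (v i - x) (v (i + 1) - v i) =
      ∑ i, angle (v (i + 1) - x) (v (i + 2) - v (i + 1)) := by
    rw [← Equiv.sum_comp (Equiv.addRight (1 : Fin (k + 3)))]
    exact Finset.sum_congr rfl fun i _ => by simp only [Equiv.coe_addRight, add_assoc]; rfl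
  rw [Finset.sum_congr rfl fun i _ => angle_eq_sub i, Finset.sum_sub_distrib, sum_shift,
    sub_le_iff_le_add, ← Finset.sum_add_distrib]
  refine Finset.sum_le_sum fun i _ => ?_
  have := angle_le_angle_add_angle (v (i + 1) - x) (v (i + 1) - v i) (v (i + 2) - v (i + 1))
  rw [angle_comm (v (i + 1) - x) (v (i + 1) - v i)] at this
  linarith

/-- The norm of the bivector `a ∧ b`: the area of the parallelogram spanned by `a` and `b`. -/
def wedgeNorm (a b : V) : ℝ :=
  √(‖a‖ ^ 2 * ‖b‖ ^ 2 - inner ℝ a b ^ 2)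

lemma wedgeNorm_nonneg (a b : V) : 0 ≤ wedgeNorm a b := Real.sqrt_nonneg _

lemma sq_wedgeNorm (a b : V) :
    wedgeNorm a b ^ 2 = ‖a‖ ^ 2 * ‖b‖ ^ 2 - inner ℝ a b ^ 2 := by
  refine Real.sq_sqrt (sub_nonneg.2 ?_)
  rw [← mul_pow, ← sq_abs]
  exact pow_le_pow_left₀ (abs_nonneg _) (abs_real_inner_le_norm a b) 2

@[fun_prop]
lemma continuous_wedgeNorm {α : Type*} [TopologicalSpace α] {f g : α → V}
    (hf : Continuous f) (hg : Continuous g) : Continuous fun a => wedgeNorm (f a) (g a) := by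
  unfold wedgeNorm
  fun_prop

@[simp]
lemma wedgeNorm_zero_left (b : V) : wedgeNorm 0 b = 0 := by
  simp [wedgeNorm]

@[simp]
lemma wedgeNorm_zero_right (a : V) : wedgeNorm a 0 = 0 := by
  simp [wedgeNorm]

lemma wedgeNorm_smul_right (a b : V) {c : ℝ} (hc : 0 ≤ c) :
    wedgeNorm a (c • b) = c * wedgeNorm a b := by
  rw [← sq_eq_sq₀ (wedgeNorm_nonneg _ _) (mul_nonneg hc (wedgeNorm_nonneg _ _)), mul_pow,
    sq_wedgeNorm, sq_wedgeNorm, norm_smul, inner_smul_right, Real.norm_of_nonneg hc]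
  ring

lemma wedgeNorm_sub_right (a b : V) : wedgeNorm a (b - a) = wedgeNorm a b := by
  rw [← sq_eq_sq₀ (wedgeNorm_nonneg _ _) (wedgeNorm_nonneg _ _), sq_wedgeNorm, sq_wedgeNorm,
    inner_sub_right, norm_sub_sq_real, real_inner_self_eq_norm_sq, real_inner_comm]
  ring

lemma wedgeNorm_eq_sin_angle_mul (a b : V) :
    wedgeNorm a b = Real.sin (angle a b) * (‖a‖ * ‖b‖) := by
  rw [sin_angle_mul_norm_mul_norm, wedgeNorm]
  simp only [real_inner_self_eq_norm_sq, sq]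

lemma wedgeNorm_eq_norm_mul_norm_starProjection (a v : V) :
    wedgeNorm a v = ‖v‖ * ‖(ℝ ∙ v)ᗮ.starProjection a‖ := by
  rcases eq_or_ne v 0 with rfl | hv
  · simp
  rw [← sq_eq_sq₀ (wedgeNorm_nonneg _ _) (by positivity), sq_wedgeNorm, mul_pow,
    ← sub_eq_iff_eq_add'.2 (Submodule.norm_sq_eq_add_norm_sq_starProjection a (ℝ ∙ v)),
    Submodule.starProjection_singleton, norm_smul, real_inner_comm]
  simp only [RCLike.ofReal_real_eq_id, id_eq, Real.norm_eq_abs, mul_pow, sq_abs, div_pow]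
  field_simp

lemma norm_mul_abs_inner_le_wedgeNorm (a : V) {v ν : V} (hν : ‖ν‖ ≤ 1) (h : inner ℝ ν v = 0) :
    ‖v‖ * |inner ℝ a ν| ≤ wedgeNorm a v := by
  have hmem : ν ∈ (ℝ ∙ v)ᗮ := Submodule.mem_orthogonal_singleton_iff_inner_left.2 h
  rw [wedgeNorm_eq_norm_mul_norm_starProjection,
    ← Submodule.starProjection_eq_self_iff.2 hmem, ← Submodule.inner_starProjection_left_eq_right]
  gcongr
  exact (abs_real_inner_le_norm _ _).trans (mul_le_of_le_one_right (norm_nonneg _) hν)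

end InnerProduct

/-! ### Closed curves: projection from a point, length and tangents -/

section AngularSpeed

variable {V : Type*} [NormedAddCommGroup V] [InnerProductSpace ℝ V]

/-- A lower bound for the angle between `a` and `b`, infinitesimally equivalent to the angle for
nearby vectors of norm much larger than `s`, but continuous at `a = 0` and `b = 0`. -/
def regAngle (s : ℝ) (a b : V) : ℝ :=
  wedgeNorm a b / (s ^ 2 + ‖a‖ * ‖b‖)

lemma regAngle_le_angle {s : ℝ} (hs : s ≠ 0) (a b : V) : regAngle s a b ≤ angle a b := by
  have hangle := angle_nonneg a b
  rw [regAngle, div_le_iff₀ (by positivity), wedgeNorm_eq_sin_angle_mul]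
  calc Real.sin (angle a b) * (‖a‖ * ‖b‖) ≤ angle a b * (‖a‖ * ‖b‖) := by
        gcongr
        exact Real.sin_le hangle
    _ ≤ angle a b * (s ^ 2 + ‖a‖ * ‖b‖) := by
        gcongr
        exact le_add_of_nonneg_left (sq_nonneg s)

@[simp]
lemma regAngle_zero_left (s : ℝ) (b : V) : regAngle s 0 b = 0 := by
  simp [regAngle]

@[simp]
lemma regAngle_zero_right (s : ℝ) (a : V) : regAngle s a 0 = 0 := by
  simp [regAngle]

/-- The speed of the projection of `γ` to the unit sphere about `x`, regularized at scale `s` so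
that it stays bounded when `γ` passes through `x`. -/
def angularSpeed (γ : ℝ → V) (x : V) (s t : ℝ) : ℝ :=
  wedgeNorm (γ t - x) (deriv γ t) / (s ^ 2 + ‖γ t - x‖ ^ 2)

lemma angularSpeed_nonneg (γ : ℝ → V) (x : V) (s t : ℝ) : 0 ≤ angularSpeed γ x s t :=
  div_nonneg (wedgeNorm_nonneg _ _) (by positivity)

lemma continuous_angularSpeed {γ : ℝ → V} (hγ : ContDiff ℝ 1 γ) (x : V) {s : ℝ} (hs : s ≠ 0) :
    Continuous (angularSpeed γ x s) := by
  have hγc := hγ.continuous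
  have := hγ.continuous_deriv le_rfl
  unfold angularSpeed
  exact Continuous.div (by fun_prop) (by fun_prop) fun t => by positivity

lemma exists_continuous_diffQuotient {F : Type*} [NormedAddCommGroup F] [NormedSpace ℝ F]
    [CompleteSpace F] {γ : ℝ → F} (hγ : ContDiff ℝ 1 γ) :
    ∃ Δ : ℝ × ℝ → F, Continuous Δ ∧ (∀ a, Δ (a, a) = deriv γ a) ∧
      ∀ a b, (b - a) • Δ (a, b) = γ b - γ a := by
  have hγ' : Continuous (deriv γ) := hγ.continuous_deriv le_rfl
  refine ⟨fun p => ∫ θ in (0 : ℝ)..1, deriv γ (p.1 + θ * (p.2 - p.1)), ?_, fun a => by simp,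
    fun a b => ?_⟩
  · exact intervalIntegral.continuous_parametric_intervalIntegral_of_continuous' (by fun_prop) 0 1
  · have h := intervalIntegral.smul_integral_comp_add_mul (a := 0) (b := 1) (deriv γ) (b - a) a
    simp only [mul_comm (b - a), zero_mul, add_zero, one_mul, add_sub_cancel] at h
    rw [h]
    exact intervalIntegral.integral_deriv_eq_sub
      (fun t _ => hγ.differentiable one_ne_zero t) (hγ'.intervalIntegrable _ _)

lemma exists_integral_angularSpeed_le_regAngle [CompleteSpace V] {γ : ℝ → V}
    (hγ : ContDiff ℝ 1 γ) (x : V) {s : ℝ} (hs : s ≠ 0) {τ : ℝ} (hτ : 0 < τ) :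
    ∃ η > 0, ∀ a b : ℝ, 0 ≤ a → a < b → b ≤ 1 → b - a < η →
      ∫ t in a..b, angularSpeed γ x s t ≤ regAngle s (γ a - x) (γ b - x) + τ * (b - a) := by
  obtain ⟨Δ, hΔ, hΔ_diag, hΔ_smul⟩ := exists_continuous_diffQuotient hγ
  have hγc := hγ.continuous
  -- `G (a, b)` is `regAngle` of the chord divided by `b - a`, extended to the diagonal.
  let G : ℝ × ℝ → ℝ := fun p =>
    wedgeNorm (γ p.1 - x) (Δ p) / (s ^ 2 + ‖γ p.1 - x‖ * ‖γ p.2 - x‖)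
  have hG : Continuous G := Continuous.div (by fun_prop) (by fun_prop) fun p => by positivity
  have hG_diag (t) : G (t, t) = angularSpeed γ x s t := by
    simp only [G, angularSpeed, hΔ_diag, sq]
  have hG_chord {a b} (hab : a < b) : (b - a) * G (a, b) = regAngle s (γ a - x) (γ b - x) := by
    rw [← mul_div_assoc, ← wedgeNorm_smul_right _ _ (sub_pos.2 hab).le, hΔ_smul, regAngle,
      ← wedgeNorm_sub_right _ (γ b - x), sub_sub_sub_cancel_right]
  obtain ⟨η, hη, hG_unif⟩ := Metric.uniformContinuousOn_iff.1
    ((isCompact_Icc (a := ((0 : ℝ), (0 : ℝ))) (b := (1, 1))).uniformContinuousOn_of_continuous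
      hG.continuousOn) τ hτ
  refine ⟨η, hη, fun a b ha hab hb hba => ?_⟩
  have hle : ∀ t ∈ Set.Icc a b, angularSpeed γ x s t ≤ G (a, b) + τ := by
    rintro t ⟨hat, htb⟩
    have hdist : dist (t, t) (a, b) < η := by
      rw [Prod.dist_eq, Real.dist_eq, Real.dist_eq]
      exact max_lt (abs_lt.2 ⟨by linarith, by linarith⟩) (abs_lt.2 ⟨by linarith, by linarith⟩)
    have := hG_unif (t, t) ⟨⟨by linarith, by linarith⟩, by linarith, by linarith⟩
      (a, b) ⟨⟨by linarith, by linarith⟩, by linarith, by linarith⟩ hdist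
    rw [Real.dist_eq, hG_diag] at this
    linarith [le_abs_self (angularSpeed γ x s t - G (a, b))]
  calc ∫ t in a..b, angularSpeed γ x s t ≤ ∫ _ in a..b, (G (a, b) + τ) :=
        intervalIntegral.integral_mono_on hab.le
          ((continuous_angularSpeed hγ x hs).intervalIntegrable _ _) (by simp) hle
    _ = regAngle s (γ a - x) (γ b - x) + τ * (b - a) := by
        rw [intervalIntegral.integral_const, smul_eq_mul, mul_add, hG_chord hab, mul_comm τ]

end AngularSpeed

lemma exists_fine_partition {t₀ : ℝ} (ht₀ : t₀ ∈ Set.Ioo 0 1) {η : ℝ} (hη : 0 < η) :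
    ∃ (N : ℕ) (t : ℕ → ℝ), 2 ≤ N ∧ StrictMono t ∧ t 0 = 0 ∧ t N = t₀ ∧ t (2 * N) = 1 ∧
      ∀ i, t (i + 1) - t i < η := by
  obtain ⟨N, hN⟩ := exists_nat_gt (1 / η + 2)
  have hη' := one_div_pos.2 hη
  have hN2 : (2 : ℝ) < N := by linarith
  have hNη : 1 / (N : ℝ) < η := (one_div_lt (by linarith) hη).2 (by linarith)
  -- The truncated subtraction in `ℕ` makes the slope change from `t₀` to `1 - t₀` at `i = N`.
  let t : ℕ → ℝ := fun i => (t₀ * i + (1 - 2 * t₀) * (i - N : ℕ)) / N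
  have hstep (i) : t (i + 1) - t i = t₀ * (1 / N) ∨ t (i + 1) - t i = (1 - t₀) * (1 / N) := by
    rcases Nat.lt_or_ge i N with hi | hi
    · left
      simp only [t, Nat.sub_eq_zero_of_le hi, Nat.sub_eq_zero_of_le hi.le]
      push_cast
      ring
    · right
      simp only [t, Nat.succ_sub hi, Nat.cast_succ]
      ring
  have hN_inv : 0 < 1 / (N : ℝ) := by positivity
  refine ⟨N, t, by exact_mod_cast hN2.le, strictMono_nat_of_lt_succ fun i => ?_, by simp [t], ?_,
    ?_, fun i => ?_⟩
  · have := mul_pos ht₀.1 hN_inv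
    have := mul_pos (sub_pos.2 ht₀.2) hN_inv
    rcases hstep i with h | h <;> linarith
  · simp only [t, Nat.sub_self, Nat.cast_zero]
    field_simp
    ring
  · simp only [t, two_mul, Nat.add_sub_cancel]
    field_simp
    push_cast
    ring
  · rcases hstep i with h | h <;> rw [h]
    · nlinarith [ht₀.2]
    · nlinarith [ht₀.1]

section Projection

variable {n : ℕ} {γ : ℝ → E n}

lemma IsC1ClosedCurve.exists_int_of_eq (hγ : IsC1ClosedCurve γ) {a b : ℝ} (h : γ a = γ b) :
    ∃ m : ℤ, a = b + m := by
  have hfract (t) : γ (Int.fract t) = γ t := by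
    simpa using hγ.periodic.sub_int_mul_eq ⌊t⌋ (x := t)
  have hmem (t : ℝ) : Int.fract t ∈ Set.Ico (0 : ℝ) 1 :=
    ⟨Int.fract_nonneg t, Int.fract_lt_one t⟩
  obtain ⟨m, hm⟩ := Int.fract_eq_fract.1
    (hγ.simple (hmem a) (hmem b) ((hfract a).trans (h.trans (hfract b).symm)))
  exact ⟨m, sub_eq_iff_eq_add'.1 hm⟩

lemma IsC1ClosedCurve.apply_ne (hγ : IsC1ClosedCurve γ) {a b : ℝ} (hab : a < b)
    (hba : b < a + 1) : γ b ≠ γ a := by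
  intro h
  obtain ⟨m, hm⟩ := hγ.exists_int_of_eq h
  have hm0 : 0 < m := by exact_mod_cast (by linarith : (0 : ℝ) < m)
  have hm1 : m < 1 := by exact_mod_cast (by linarith : (m : ℝ) < 1)
  omega

lemma polygonCurvature_le_totalCurvature (hfin : totalCurvature γ ≠ ⊤) {k : ℕ}
    {t : Fin (k + 3) → ℝ} (ht : StrictMono t) (ht01 : ∀ i, t i ∈ Set.Ico (0 : ℝ) 1) :
    polygonCurvature (fun i => γ (t i)) ≤ (totalCurvature γ).toReal :=
  (ENNReal.ofReal_le_iff_le_toReal hfin).1 <| le_iSup_of_le k <| le_iSup_of_le t <|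
    le_iSup_of_le ht <| le_iSup_of_le ht01 le_rfl

lemma sum_angle_le_totalCurvature (hγ : IsC1ClosedCurve γ) (hfin : totalCurvature γ ≠ ⊤) (x : E n)
    {K : ℕ} (hK : 3 ≤ K) {t : ℕ → ℝ} (ht : StrictMono t) (ht0 : t 0 = 0) (ht1 : t K = 1) :
    ∑ i ∈ Finset.range K, angle (γ (t i) - x) (γ (t (i + 1)) - x) ≤ (totalCurvature γ).toReal := by
  obtain ⟨k, rfl⟩ := Nat.exists_eq_add_of_le' hK
  let v : Fin (k + 3) → E n := fun i => γ (t i)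
  have ht01 (i : Fin (k + 3)) : t i ∈ Set.Ico (0 : ℝ) 1 :=
    ⟨ht0 ▸ ht.monotone (Nat.zero_le _), ht1 ▸ ht i.2⟩
  have hv_next (i : Fin (k + 3)) : v (i + 1) = γ (t (i + 1)) := by
    rcases (Nat.succ_le_of_lt i.2).lt_or_eq with hi | hi
    · simp only [v, Fin.val_add_one_of_lt' hi]
    · have hlast : i = Fin.last (k + 2) := Fin.ext (by simpa using hi)
      have hclose : γ 1 = γ 0 := by simpa using hγ.periodic 0
      rw [show (i : ℕ) + 1 = k + 3 from hi, ht1, hlast, Fin.last_add_one, hclose]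
      simp [v, ht0]
  have hv_ne (i : Fin (k + 3)) : v (i + 1) ≠ v i := by
    rw [hv_next]
    refine hγ.apply_ne (ht (Nat.lt_succ_self _)) ?_
    rcases Nat.eq_zero_or_pos (i : ℕ) with hi | hi
    · rw [hi, ht0, zero_add, zero_add, ← ht1]
      exact ht (by omega)
    · have hpos : 0 < t i := ht0 ▸ ht hi
      have hle : t (i + 1) ≤ 1 := ht1 ▸ ht.monotone i.2
      linarith
  calc ∑ i ∈ Finset.range (k + 3), angle (γ (t i) - x) (γ (t (i + 1)) - x)
      = ∑ i, angle (v i - x) (v (i + 1) - x) := by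
        rw [Finset.sum_range]
        exact Finset.sum_congr rfl fun i _ => by rw [hv_next]
    _ ≤ polygonCurvature v := sum_angle_sub_le_sum_exterior_angle v hv_ne x
    _ ≤ (totalCurvature γ).toReal :=
        polygonCurvature_le_totalCurvature hfin (fun i j hij => ht hij) ht01

lemma exists_partition_integral_angularSpeed_le (hγ : ContDiff ℝ 1 γ) (x : E n) {s : ℝ}
    (hs : s ≠ 0) {t₀ : ℝ} (ht₀ : t₀ ∈ Set.Ico (0 : ℝ) 1) {τ : ℝ} (hτ : 0 < τ) :
    ∃ (K : ℕ) (t : ℕ → ℝ), 3 ≤ K ∧ StrictMono t ∧ t 0 = 0 ∧ t K = 1 ∧ (∃ j < K, t j = t₀) ∧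
      ∫ r in (0 : ℝ)..1, angularSpeed γ x s r ≤
        ∑ i ∈ Finset.range K, regAngle s (γ (t i) - x) (γ (t (i + 1)) - x) + τ := by
  obtain ⟨η, hη, hint⟩ := exists_integral_angularSpeed_le_regAngle hγ x hs hτ
  obtain ⟨a, ha, hta⟩ : ∃ a ∈ Set.Ioo (0 : ℝ) 1, t₀ = 0 ∨ t₀ = a := by
    rcases ht₀.1.eq_or_lt with h | h
    · exact ⟨1 / 2, by norm_num, .inl h.symm⟩
    · exact ⟨t₀, ⟨h, ht₀.2⟩, .inr rfl⟩
  obtain ⟨N, t, hN, ht, h0, hNa, h1, hmesh⟩ := exists_fine_partition ha hη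
  refine ⟨2 * N, t, by omega, ht, h0, h1, ?_, ?_⟩
  · rcases hta with h | h
    · exact ⟨0, by omega, h0.trans h.symm⟩
    · exact ⟨N, by omega, hNa.trans h.symm⟩
  calc ∫ r in (0 : ℝ)..1, angularSpeed γ x s r
      = ∑ i ∈ Finset.range (2 * N), ∫ r in t i..t (i + 1), angularSpeed γ x s r := by
        rw [intervalIntegral.sum_integral_adjacent_intervals, h0, h1]
        exact fun i _ => (continuous_angularSpeed hγ x hs).intervalIntegrable _ _
    _ ≤ ∑ i ∈ Finset.range (2 * N),
          (regAngle s (γ (t i) - x) (γ (t (i + 1)) - x) + τ * (t (i + 1) - t i)) := by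
        refine Finset.sum_le_sum fun i hi => hint _ _ ?_ (ht i.lt_succ_self) ?_ (hmesh i)
        · exact h0 ▸ ht.monotone i.zero_le
        · exact h1 ▸ ht.monotone (Finset.mem_range.1 hi)
    _ = _ := by
        rw [Finset.sum_add_distrib, ← Finset.mul_sum, Finset.sum_range_sub, h0, h1, sub_zero,
          mul_one]

theorem integral_angularSpeed_le_totalCurvature (hγ : IsC1ClosedCurve γ)
    (hfin : totalCurvature γ ≠ ⊤) (x : E n) {s : ℝ} (hs : s ≠ 0) :
    ∫ t in (0 : ℝ)..1, angularSpeed γ x s t ≤ (totalCurvature γ).toReal := by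
  refine le_of_forall_pos_le_add fun τ hτ => ?_
  obtain ⟨K, t, hK, ht, h0, h1, -, hint⟩ := exists_partition_integral_angularSpeed_le
    hγ.contDiff x hs (Set.left_mem_Ico.2 one_pos) hτ
  refine hint.trans (add_le_add_left ((Finset.sum_le_sum fun i _ => ?_).trans
    (sum_angle_le_totalCurvature hγ hfin x hK ht h0 h1)) τ)
  exact regAngle_le_angle hs _ _

theorem integral_angularSpeed_add_pi_le_totalCurvature (hγ : IsC1ClosedCurve γ)
    (hfin : totalCurvature γ ≠ ⊤) {x : E n} (hx : x ∈ Set.range γ) {s : ℝ} (hs : s ≠ 0) :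
    (∫ t in (0 : ℝ)..1, angularSpeed γ x s t) + Real.pi ≤ (totalCurvature γ).toReal := by
  refine le_of_forall_pos_le_add fun τ hτ => ?_
  obtain ⟨t₀, ht₀, rfl⟩ : ∃ t₀ ∈ Set.Ico (0 : ℝ) 1, x = γ t₀ := by
    obtain ⟨r, rfl⟩ := hx
    exact hγ.periodic.exists_mem_Ico₀ one_pos r
  obtain ⟨K, t, hK, ht, h0, h1, ⟨j, hj, hjt⟩, hint⟩ := exists_partition_integral_angularSpeed_le
    hγ.contDiff (γ t₀) hs ht₀ hτ
  have hclose : γ 1 = γ 0 := by simpa using hγ.periodic 0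
  obtain ⟨j', hj', hne, hjt'⟩ : ∃ j' < K, j ≠ j' ∧ γ (t (j' + 1)) = γ t₀ := by
    rcases j with - | j
    · refine ⟨K - 1, by omega, by omega, ?_⟩
      rw [Nat.sub_add_cancel (by omega), h1, hclose, ← h0, hjt]
    · exact ⟨j, by omega, by omega, by rw [hjt]⟩
  -- The angle with a zero vector is `π / 2`, so each of the two edges at `γ t₀` gains `π / 2`.
  have gain : ∑ i ∈ {j, j'}, (angle (γ (t i) - γ t₀) (γ (t (i + 1)) - γ t₀) -
        regAngle s (γ (t i) - γ t₀) (γ (t (i + 1)) - γ t₀)) ≤ ∑ i ∈ Finset.range K,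
      (angle (γ (t i) - γ t₀) (γ (t (i + 1)) - γ t₀) -
        regAngle s (γ (t i) - γ t₀) (γ (t (i + 1)) - γ t₀)) :=
    Finset.sum_le_sum_of_subset_of_nonneg (by simp [Finset.insert_subset_iff, hj, hj'])
      fun i _ _ => sub_nonneg.2 (regAngle_le_angle hs _ _)
  rw [Finset.sum_pair hne, hjt, hjt', sub_self, angle_zero_left, angle_zero_right,
    regAngle_zero_left, regAngle_zero_right, Finset.sum_sub_distrib] at gain
  have := sum_angle_le_totalCurvature hγ hfin (γ t₀) hK ht h0 h1
  linarith

end Projection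

section Length

variable {F : Type*} [NormedAddCommGroup F] [NormedSpace ℝ F] [MeasurableSpace F] [BorelSpace F]
  {γ : ℝ → F}

lemma hausdorffMeasure_image_le_of_nnnorm_sub_deriv_le {B J : Set ℝ} (hJ : Convex ℝ J)
    (hγ : ∀ t ∈ J, DifferentiableAt ℝ γ t) {τ : NNReal}
    (hτ : ∀ a ∈ J, ∀ b ∈ J, ‖deriv γ a - deriv γ b‖₊ ≤ τ) (hB : MeasurableSet B) (hBJ : B ⊆ J) :
    μH[1] (γ '' B) ≤ ∫⁻ t in B, (‖deriv γ t‖ₑ + 2 * τ) := by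
  rcases B.eq_empty_or_nonempty with rfl | ⟨c, hc⟩
  · simp
  have hdiff {a b : ℝ} (ha : a ∈ J) (hb : b ∈ J) : ‖deriv γ a‖₊ ≤ ‖deriv γ b‖₊ + τ := by
    have := nnnorm_add_le (deriv γ b) (deriv γ a - deriv γ b)
    rw [add_sub_cancel] at this
    exact this.trans (by gcongr; exact hτ a ha b hb)
  have hlip : LipschitzOnWith (‖deriv γ c‖₊ + τ) γ J :=
    hJ.lipschitzOnWith_of_nnnorm_deriv_le hγ fun t ht => hdiff ht (hBJ hc)
  calc μH[1] (γ '' B) ≤ (‖deriv γ c‖₊ + τ : NNReal) * volume B := by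
        simpa [hausdorffMeasure_real] using
          (hlip.mono hBJ).hausdorffMeasure_image_le (d := 1) zero_le_one
    _ = ∫⁻ _ in B, (‖deriv γ c‖₊ + τ : NNReal) := (setLIntegral_const _ _).symm
    _ ≤ ∫⁻ t in B, (‖deriv γ t‖ₑ + 2 * τ) := by
        refine setLIntegral_mono' hB fun t ht => ?_
        rw [enorm_eq_nnnorm]
        norm_cast
        rw [two_mul, ← add_assoc]
        gcongr
        exact hdiff (hBJ hc) (hBJ ht)

lemma hausdorffMeasure_image_le_lintegral_add (hγ : ContDiff ℝ 1 γ) {a b : ℝ} {B : Set ℝ}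
    (hB : MeasurableSet B) (hBab : B ⊆ Set.Icc a b) {τ : NNReal} (hτ : 0 < τ) :
    μH[1] (γ '' B) ≤ ∫⁻ t in B, (‖deriv γ t‖ₑ + 2 * τ) := by
  obtain ⟨p, hp, hunif⟩ := Metric.uniformContinuousOn_iff.1
    (isCompact_Icc.uniformContinuousOn_of_continuous
      (hγ.continuous_deriv le_rfl).continuousOn) τ (NNReal.coe_pos.2 hτ)
  let I (k : ℤ) : Set ℝ := Set.Ico (k • p) ((k + 1) • p)
  have hI : ⋃ k, B ∩ I k = B := by
    rw [← Set.inter_iUnion, iUnion_Ico_zsmul hp, Set.inter_univ]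
  have hBI (k) : MeasurableSet (B ∩ I k) := hB.inter measurableSet_Ico
  have hpiece (k) : μH[1] (γ '' (B ∩ I k)) ≤ ∫⁻ t in B ∩ I k, (‖deriv γ t‖ₑ + 2 * τ) := by
    refine hausdorffMeasure_image_le_of_nnnorm_sub_deriv_le
      ((convex_Icc a b).inter (convex_Ico _ _)) (fun t _ => hγ.differentiable one_ne_zero t)
      (fun x hx y hy => ?_) (hBI k) (Set.inter_subset_inter_left _ hBab)
    rw [← NNReal.coe_le_coe, coe_nnnorm, ← dist_eq_norm]
    refine (hunif x hx.1 y hy.1 ?_).le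
    have := add_one_zsmul p k
    rw [Real.dist_eq, abs_lt]
    constructor <;> linarith [hx.2.1, hx.2.2, hy.2.1, hy.2.2]
  calc μH[1] (γ '' B) = μH[1] (⋃ k, γ '' (B ∩ I k)) := by rw [← Set.image_iUnion, hI]
    _ ≤ ∑' k, μH[1] (γ '' (B ∩ I k)) := measure_iUnion_le _
    _ ≤ ∑' k, ∫⁻ t in B ∩ I k, (‖deriv γ t‖ₑ + 2 * τ) := ENNReal.tsum_le_tsum hpiece
    _ = ∫⁻ t in B, (‖deriv γ t‖ₑ + 2 * τ) := by
        rw [← lintegral_iUnion hBI, hI]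
        exact fun k l hkl => (Set.pairwise_disjoint_Ico_zsmul p hkl).mono
          Set.inter_subset_right Set.inter_subset_right

lemma hausdorffMeasure_image_le_lintegral (hγ : ContDiff ℝ 1 γ) {a b : ℝ} {B : Set ℝ}
    (hB : MeasurableSet B) (hBab : B ⊆ Set.Icc a b) :
    μH[1] (γ '' B) ≤ ∫⁻ t in B, ‖deriv γ t‖ₑ := by
  have hvol : volume B ≠ ⊤ := measure_ne_top_of_subset hBab (by simp)
  have hcont : Continuous fun τ : NNReal => (∫⁻ t in B, ‖deriv γ t‖ₑ) + 2 * τ * volume B :=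
    ((ENNReal.continuous_mul_const hvol).comp
      ((ENNReal.continuous_const_mul (by simp)).comp ENNReal.continuous_coe)).const_add _
  have hlim := hcont.tendsto 0 |>.mono_left (nhdsWithin_le_nhds (s := Set.Ioi 0))
  rw [ENNReal.coe_zero, mul_zero, zero_mul, add_zero] at hlim
  refine ge_of_tendsto hlim ?_
  filter_upwards [self_mem_nhdsWithin] with τ hτ
  refine (hausdorffMeasure_image_le_lintegral_add hγ hB hBab hτ).trans_eq ?_
  rw [lintegral_add_right _ measurable_const, setLIntegral_const]

lemma lintegral_hausdorffMeasure_range_le (hγ : ContDiff ℝ 1 γ) (hper : Function.Periodic γ 1)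
    (f : F → ℝ≥0∞) :
    ∫⁻ x in Set.range γ, f x ∂μH[1] ≤ ∫⁻ t in Set.Ioc (0 : ℝ) 1, ‖deriv γ t‖ₑ * f (γ t) := by
  have hc := hγ.continuous.measurable
  let m : Measure ℝ := (volume.restrict (Set.Ioc (0 : ℝ) 1)).withDensity fun t => ‖deriv γ t‖ₑ
  have hle : (μH[1] : Measure F).restrict (Set.range γ) ≤ m.map γ := by
    refine Measure.le_iff.2 fun A hA => ?_
    rw [Measure.restrict_apply hA, Measure.map_apply hc hA, withDensity_apply _ (hc hA),
      Measure.restrict_restrict (hc hA), ← hper.image_Ioc one_pos 0, zero_add,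
      ← Set.image_preimage_inter]
    exact hausdorffMeasure_image_le_lintegral hγ ((hc hA).inter measurableSet_Ioc)
      (Set.inter_subset_right.trans Set.Ioc_subset_Icc_self)
  calc ∫⁻ x in Set.range γ, f x ∂μH[1] ≤ ∫⁻ x, f x ∂m.map γ := lintegral_mono' hle le_rfl
    _ ≤ ∫⁻ t, f (γ t) ∂m := lintegral_map_le _ _
    _ = _ := lintegral_withDensity_eq_lintegral_mul_non_measurable _
        (hγ.continuous_deriv le_rfl).enorm.measurable (by simp) _

end Length

section Tangent

variable {n : ℕ} {γ : ℝ → E n}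

lemma IsC1ClosedCurve.nhdsWithin_range_le_map (hγ : IsC1ClosedCurve γ) (t₀ : ℝ) :
    𝓝[Set.range γ] (γ t₀) ≤ map γ (𝓝 t₀) := by
  intro S hS
  obtain ⟨η, hη, hηS⟩ := Metric.mem_nhds_iff.1 (mem_map.1 hS)
  have hK : IsCompact (γ '' Set.Icc (t₀ + η) (t₀ + 1 - η)) :=
    isCompact_Icc.image hγ.contDiff.continuous
  have hmem : γ t₀ ∉ γ '' Set.Icc (t₀ + η) (t₀ + 1 - η) := by
    rintro ⟨t, ht, he⟩
    exact hγ.apply_ne (by linarith [ht.1]) (by linarith [ht.2]) he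
  refine mem_nhdsWithin.2 ⟨_, hK.isClosed.isOpen_compl, hmem, ?_⟩
  rintro x ⟨hx, r, rfl⟩
  obtain ⟨t, ht, he⟩ := hγ.periodic.exists_mem_Ico one_pos r t₀
  rw [he] at hx ⊢
  rcases lt_or_ge t (t₀ + η) with h | h
  · exact hηS (by rw [Metric.mem_ball, Real.dist_eq, abs_lt]; constructor <;> linarith [ht.1])
  have h' : t₀ + 1 - η < t := not_le.1 fun h' => hx ⟨t, ⟨h, h'⟩, rfl⟩
  rw [← hγ.periodic.sub_eq]
  exact hηS (by rw [Metric.mem_ball, Real.dist_eq, abs_lt]; constructor <;> linarith [ht.2])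

lemma IsC1ClosedCurve.isLittleO_starProjection_sub (hγ : IsC1ClosedCurve γ) (t₀ : ℝ) :
    (fun x => (ℝ ∙ deriv γ t₀)ᗮ.starProjection (x - γ t₀))
      =o[𝓝[Set.range γ] (γ t₀)] fun x => x - γ t₀ := by
  refine Asymptotics.IsLittleO.mono ?_ (hγ.nhdsWithin_range_le_map t₀)
  rw [Asymptotics.isLittleO_map]
  have hderiv : HasDerivAt γ (deriv γ t₀) t₀ :=
    (hγ.contDiff.differentiable one_ne_zero t₀).hasDerivAt
  have hproj : (ℝ ∙ deriv γ t₀)ᗮ.starProjection (deriv γ t₀) = 0 :=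
    Submodule.starProjection_orthogonal_apply_eq_zero (Submodule.mem_span_singleton_self _)
  have hlo := ((ℝ ∙ deriv γ t₀)ᗮ.starProjection.hasFDerivAt.comp_hasDerivAt t₀ hderiv).isLittleO
  simp only [hproj, smul_zero, sub_zero, Function.comp_apply, ← map_sub] at hlo
  have hO := (hderiv.isTheta_sub (hγ.regular t₀)).isBigO_symm
  rw [prod_pure, Asymptotics.isBigO_map] at hO
  exact hlo.trans_isBigO hO

lemma IsC1ClosedCurve.exists_injOn_inner_deriv (hγ : IsC1ClosedCurve γ) (t₀ : ℝ) :
    ∃ U ∈ 𝓝[Set.range γ] (γ t₀), Set.InjOn (fun x => inner ℝ (x - γ t₀) (deriv γ t₀)) U := by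
  let f : ℝ → ℝ := fun t => inner ℝ (γ t - γ t₀) (deriv γ t₀)
  have hf : HasStrictDerivAt f (inner ℝ (deriv γ t₀) (deriv γ t₀)) t₀ := by
    have hγ' : HasStrictDerivAt γ (deriv γ t₀) t₀ :=
      hγ.contDiff.contDiffAt.hasStrictDerivAt one_ne_zero
    have := ((innerSL ℝ (deriv γ t₀)).hasStrictFDerivAt.comp_hasStrictDerivAt t₀
      (hγ'.sub_const (γ t₀)))
    simpa [f, Function.comp_def, real_inner_comm] using this
  have hinj : ∀ᶠ p in 𝓝 t₀ ×ˢ 𝓝 t₀, f p.1 - f p.2 = 0 → p.1 - p.2 = 0 := by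
    rw [← nhds_prod_eq]
    exact (hf.isTheta_sub (inner_self_ne_zero.2 (hγ.regular t₀))).isBigO_symm.eq_zero_imp
  obtain ⟨T, hT, hTinj⟩ := mem_prod_same_iff.1 hinj
  refine ⟨γ '' T, hγ.nhdsWithin_range_le_map t₀ (image_mem_map hT), ?_⟩
  rintro _ ⟨a, ha, rfl⟩ _ ⟨b, hb, rfl⟩ hab
  exact congrArg γ (sub_eq_zero.1 (hTinj (Set.mk_mem_prod ha hb) (sub_eq_zero.2 hab)))

lemma IsC1ClosedCurve.starProjection_eq_zero_of_tendsto (hγ : IsC1ClosedCurve γ) (t₀ : ℝ)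
    {σ : ℝ → E n} {k : ℕ} (hk : k ≠ 0) {v : E n} (hσ : ∀ᶠ s in 𝓝[≠] 0, σ s ∈ Set.range γ)
    (hlim : Tendsto (fun s => (s ^ k)⁻¹ • (σ s - γ t₀)) (𝓝[≠] 0) (𝓝 v)) :
    (ℝ ∙ deriv γ t₀)ᗮ.starProjection v = 0 := by
  have hpow : Tendsto (fun s : ℝ => s ^ k) (𝓝[≠] 0) (𝓝 0) := by
    have := ((continuous_pow k).tendsto (0 : ℝ)).mono_left (nhdsWithin_le_nhds (s := {0}ᶜ))
    rwa [zero_pow hk] at this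
  have hcancel : ∀ᶠ s in 𝓝[≠] (0 : ℝ), s ^ k • (s ^ k)⁻¹ • (σ s - γ t₀) = σ s - γ t₀ := by
    filter_upwards [self_mem_nhdsWithin] with s hs
    exact smul_inv_smul₀ (pow_ne_zero k hs) _
  have hσ_lim : Tendsto σ (𝓝[≠] 0) (𝓝[Set.range γ] (γ t₀)) := by
    refine tendsto_nhdsWithin_iff.2 ⟨tendsto_sub_nhds_zero_iff.1 ?_, hσ⟩
    simpa using (hpow.smul hlim).congr' hcancel
  have hlo : (fun s => (s ^ k)⁻¹ • (ℝ ∙ deriv γ t₀)ᗮ.starProjection (σ s - γ t₀)) =o[𝓝[≠] 0]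
      fun s => (s ^ k)⁻¹ • (σ s - γ t₀) :=
    (Asymptotics.isBigO_refl _ _).smul_isLittleO
      ((hγ.isLittleO_starProjection_sub t₀).comp_tendsto hσ_lim)
  have hzero := (Asymptotics.isLittleO_one_iff ℝ).1 (hlo.trans_isBigO (hlim.isBigO_one ℝ))
  refine tendsto_nhds_unique
    (((ℝ ∙ deriv γ t₀)ᗮ.starProjection.continuous.tendsto v).comp hlim) ?_
  simpa only [← map_smul, Function.comp_def] using hzero

end Tangent

/-! ### The Jacobian -/

section Jacobian

lemma wedgeNorm_map_le {V W : Type*} [NormedAddCommGroup V] [InnerProductSpace ℝ V]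
    [NormedAddCommGroup W] [InnerProductSpace ℝ W] {Q : V →L[ℝ] W} (hQ : ‖Q‖ ≤ 1) (a b : V) :
    wedgeNorm (Q a) (Q b) ≤ wedgeNorm a b := by
  have norm_map_le (y : V) : ‖Q y‖ ≤ ‖y‖ := by simpa using Q.le_of_opNorm_le hQ y
  obtain ⟨c, hc⟩ := Submodule.mem_span_singleton.1
    (Submodule.starProjection_apply_mem (ℝ ∙ b) a)
  have starProjection_a : (ℝ ∙ b)ᗮ.starProjection a = a - c • b := by
    rw [Submodule.starProjection_orthogonal_val, hc]
  have le_norm_sub : ‖(ℝ ∙ Q b)ᗮ.starProjection (Q a)‖ ≤ ‖Q a - c • Q b‖ := by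
    have projection_smul : (ℝ ∙ Q b)ᗮ.starProjection (c • Q b) = 0 :=
      Submodule.starProjection_orthogonal_apply_eq_zero
        (Submodule.smul_mem _ c (Submodule.mem_span_singleton_self _))
    rw [← sub_zero ((ℝ ∙ Q b)ᗮ.starProjection (Q a)), ← projection_smul, ← map_sub]
    exact Submodule.norm_starProjection_apply_le _ _
  rw [wedgeNorm_eq_norm_mul_norm_starProjection, wedgeNorm_eq_norm_mul_norm_starProjection,
    starProjection_a]
  gcongr
  · exact norm_map_le b
  · exact le_norm_sub.trans (by simpa using norm_map_le (a - c • b))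

lemma normDet_eq_wedgeNorm {V : Type*} [NormedAddCommGroup V] [InnerProductSpace ℝ V]
    (D : E 2 →ₗ[ℝ] V) :
    D.normDet = wedgeNorm (D (EuclideanSpace.single 0 1)) (D (EuclideanSpace.single 1 1)) := by
  have h := D.normDet_sq_eq_det_gram (EuclideanSpace.basisFun (Fin 2) ℝ)
  rw [Matrix.det_fin_two] at h
  simp only [Matrix.gram_apply, EuclideanSpace.basisFun_apply, real_inner_self_eq_norm_sq,
    real_inner_comm (D (EuclideanSpace.single 0 1)) (D (EuclideanSpace.single 1 1))] at h
  rw [← sq_eq_sq₀ D.normDet_nonneg (wedgeNorm_nonneg _ _), sq_wedgeNorm, sq (inner ℝ _ _)]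
  exact h

lemma continuous_normDet {V : Type*} [NormedAddCommGroup V] [InnerProductSpace ℝ V] :
    Continuous fun D : E 2 →L[ℝ] V => D.toLinearMap.normDet := by
  simp only [normDet_eq_wedgeNorm, ContinuousLinearMap.coe_coe]
  fun_prop

lemma normDet_comp_le {V W : Type*} [NormedAddCommGroup V] [InnerProductSpace ℝ V]
    [NormedAddCommGroup W] [InnerProductSpace ℝ W] {Q : V →L[ℝ] W} (hQ : ‖Q‖ ≤ 1)
    (D : E 2 →ₗ[ℝ] V) : (Q.toLinearMap ∘ₗ D).normDet ≤ D.normDet := by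
  rw [normDet_eq_wedgeNorm, normDet_eq_wedgeNorm]
  exact wedgeNorm_map_le hQ _ _

lemma normDet_smul_complex (c : ℂ) (D : E 2 →ₗ[ℝ] ℂ) :
    (c • D).normDet = ‖c‖ ^ 2 * D.normDet := by
  have hc : c • D = LinearMap.mulLeft ℝ c ∘ₗ D := rfl
  rw [hc, LinearMap.normDet_comp_of_finrank_eq _ _ (by simp),
    LinearMap.normDet_eq_abs_det,
    show (LinearMap.mulLeft ℝ c).det = ‖c‖ ^ 2 from
      (Algebra.norm_complex_apply c).trans (Complex.normSq_eq_norm_sq c), abs_sq]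

variable {n : ℕ}

lemma jacobian_eq_normDet (D : E 2 →L[ℝ] E n) : jacobian D = D.toLinearMap.normDet := by
  have h := D.normDet_sq
  rw [RCLike.ofReal_real_eq_id, id_eq] at h
  rw [jacobian, ← h, Real.sqrt_sq D.toLinearMap.normDet_nonneg]

lemma continuous_jacobian : Continuous (jacobian : (E 2 →L[ℝ] E n) → ℝ) := by
  simpa only [← jacobian_eq_normDet] using continuous_normDet (V := E n)

lemma jacobian_comp (D : E 2 →L[ℝ] E n) (T : E 2 →L[ℝ] E 2) :
    jacobian (D ∘L T) = |T.det| * jacobian D := by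
  rw [jacobian_eq_normDet, jacobian_eq_normDet, ContinuousLinearMap.toLinearMap_comp,
    LinearMap.normDet_comp_of_finrank_eq _ _ rfl, LinearMap.normDet_eq_abs_det T.toLinearMap,
    mul_comm]

lemma jacobian_eq_zero_iff {D : E 2 →L[ℝ] E n} : jacobian D = 0 ↔ ¬Function.Injective D := by
  rw [jacobian_eq_normDet, LinearMap.normDet_eq_zero_iff_ker_ne_bot, Ne, LinearMap.ker_eq_bot]
  rfl

end Jacobian

/-! ### Charts and the area measure -/

section Area

variable {n : ℕ} {M : Type*} [TopologicalSpace M] [ChartedSpace (EuclideanHalfSpace 2) M]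
  {u : M → E n}

/-- The differential at `x` of the map `u` read in the chart at `p`. -/
def chartDeriv (u : M → E n) (p : M) (x : E 2) : E 2 →L[ℝ] E n :=
  fderivWithin ℝ (u ∘ (extChartAt (𝓡∂ 2) p).symm) (Set.range (𝓡∂ 2)) x

/-- The change of coordinates from the chart at `q` to the chart at `p`. -/
def transition (p q : M) : E 2 → E 2 :=
  extChartAt (𝓡∂ 2) p ∘ (extChartAt (𝓡∂ 2) q).symm

lemma measurableSet_extChartAt_target (p : M) : MeasurableSet (extChartAt (𝓡∂ 2) p).target := by
  rw [extChartAt_target]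
  exact ((chartAt _ p).open_target.preimage (𝓡∂ 2).continuous_symm).measurableSet.inter
    (𝓡∂ 2).isClosed_range.measurableSet

lemma uniqueDiffWithinAt_range_of_mem_target {p : M} {x : E 2}
    (hx : x ∈ (extChartAt (𝓡∂ 2) p).target) :
    UniqueDiffWithinAt ℝ (Set.range (𝓡∂ 2)) x :=
  (𝓡∂ 2).uniqueDiffOn x (extChartAt_target_subset_range p hx)

lemma du_eq_chartDeriv (hu : ContMDiff (𝓡∂ 2) 𝓘(ℝ, E n) 1 u) (q : M) :
    du u q = chartDeriv u q (extChartAt (𝓡∂ 2) q q) :=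
  (hu.mdifferentiableAt one_ne_zero).mfderiv

section ChartArea

variable [MeasurableSpace M] [BorelSpace M]

lemma measurableSet_symm_preimage_inter_target (p : M) {A : Set M} (hA : MeasurableSet A) :
    MeasurableSet ((extChartAt (𝓡∂ 2) p).symm ⁻¹' A ∩ (extChartAt (𝓡∂ 2) p).target) := by
  have h := (continuousOn_extChartAt_symm (I := 𝓡∂ 2) p).domRestrict.measurable hA
  convert (measurableSet_extChartAt_target p).subtype_image h using 1
  ext x
  simp

lemma chartArea_apply (u : M → E n) (p : M) {A : Set M} (hA : MeasurableSet A) :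
    chartArea u p A = ∫⁻ x in (extChartAt (𝓡∂ 2) p).symm ⁻¹' A ∩ (extChartAt (𝓡∂ 2) p).target,
      ENNReal.ofReal (jacobian (chartDeriv u p x)) := by
  have hsymm : AEMeasurable (extChartAt (𝓡∂ 2) p).symm
      ((volume.restrict (extChartAt (𝓡∂ 2) p).target).withDensity fun x =>
        ENNReal.ofReal (jacobian (chartDeriv u p x))) :=
    ((continuousOn_extChartAt_symm p).aemeasurable (measurableSet_extChartAt_target p)).mono_ac
      (withDensity_absolutelyContinuous _ _)
  refine (Measure.map_apply_of_aemeasurable hsymm hA).trans ?_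
  rw [withDensity_apply', Measure.restrict_restrict' (measurableSet_extChartAt_target p)]

lemma chartArea_inter_source (u : M → E n) (p : M) {A : Set M} (hA : MeasurableSet A) :
    chartArea u p (A ∩ (extChartAt (𝓡∂ 2) p).source) = chartArea u p A := by
  rw [chartArea_apply u p hA,
    chartArea_apply u p (hA.inter (isOpen_extChartAt_source p).measurableSet),
    Set.preimage_inter, Set.inter_assoc,
    Set.inter_eq_right.2 (extChartAt (𝓡∂ 2) p).target_subset_preimage_source]

end ChartArea

variable [IsManifold (𝓡∂ 2) 1 M]

section Differential

lemma contDiffOn_comp_extChartAt_symm {F : Type*} [NormedAddCommGroup F] [NormedSpace ℝ F]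
    {f : M → F} (hf : ContMDiff (𝓡∂ 2) 𝓘(ℝ, F) 1 f) (p : M) :
    ContDiffOn ℝ 1 (f ∘ (extChartAt (𝓡∂ 2) p).symm) (extChartAt (𝓡∂ 2) p).target :=
  contMDiffOn_iff_contDiffOn.1 (hf.comp_contMDiffOn (contMDiffOn_extChartAt_symm p))

lemma hasFDerivWithinAt_chartDeriv (hu : ContMDiff (𝓡∂ 2) 𝓘(ℝ, E n) 1 u) {p : M} {x : E 2}
    (hx : x ∈ (extChartAt (𝓡∂ 2) p).target) :
    HasFDerivWithinAt (u ∘ (extChartAt (𝓡∂ 2) p).symm) (chartDeriv u p x) (Set.range (𝓡∂ 2)) x :=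
  (((contDiffOn_comp_extChartAt_symm hu p x hx).differentiableWithinAt one_ne_zero
    ).mono_of_mem_nhdsWithin (extChartAt_target_mem_nhdsWithin_of_mem hx)).hasFDerivWithinAt

lemma continuousOn_chartDeriv (hu : ContMDiff (𝓡∂ 2) 𝓘(ℝ, E n) 1 u) (p : M) :
    ContinuousOn (chartDeriv u p) (extChartAt (𝓡∂ 2) p).target :=
  ((contDiffOn_comp_extChartAt_symm hu p).continuousOn_fderivWithin
    (uniqueDiffOn_extChartAt_target p) le_rfl).congr fun x hx =>
      (((hasFDerivWithinAt_chartDeriv hu hx).mono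
        (extChartAt_target_subset_range p)).fderivWithin
          (uniqueDiffOn_extChartAt_target p x hx)).symm

lemma continuousAt_chartDeriv_extChartAt (hu : ContMDiff (𝓡∂ 2) 𝓘(ℝ, E n) 1 u) (p : M) :
    ContinuousAt (fun q => chartDeriv u p (extChartAt (𝓡∂ 2) p q)) p :=
  ((continuousOn_chartDeriv hu p).comp (continuousOn_extChartAt (I := 𝓡∂ 2) p)
    (extChartAt (𝓡∂ 2) p).mapsTo).continuousAt (extChartAt_source_mem_nhds p)

lemma hasFDerivWithinAt_transition (p q : M) {x : E 2} (hx : x ∈ (extChartAt (𝓡∂ 2) q).target)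
    (hxp : (extChartAt (𝓡∂ 2) q).symm x ∈ (extChartAt (𝓡∂ 2) p).source) :
    HasFDerivWithinAt (transition p q) (fderivWithin ℝ (transition p q) (Set.range (𝓡∂ 2)) x)
      (Set.range (𝓡∂ 2)) x :=
  ((contDiffWithinAt_ext_coord_change (n := 1) p q ⟨hx, hxp⟩).differentiableWithinAt
    one_ne_zero).hasFDerivWithinAt

lemma isInvertible_fderivWithin_transition (p q : M) {x : E 2}
    (hx : x ∈ (extChartAt (𝓡∂ 2) q).target)
    (hxp : (extChartAt (𝓡∂ 2) q).symm x ∈ (extChartAt (𝓡∂ 2) p).source) :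
    (fderivWithin ℝ (transition p q) (Set.range (𝓡∂ 2)) x).IsInvertible := by
  have hsrc : x ∈ ((extChartAt (𝓡∂ 2) q).symm ≫ extChartAt (𝓡∂ 2) p).source := ⟨hx, hxp⟩
  rw [fderivWithin_of_mem_nhdsWithin
    (ModelWithCorners.extendCoordChange_source_mem_nhdsWithin hsrc)
    (uniqueDiffWithinAt_range_of_mem_target hx)
    ((hasFDerivWithinAt_transition p q hx hxp).differentiableWithinAt.mono fun y hy =>
      extChartAt_target_subset_range q hy.1)]
  exact ModelWithCorners.isInvertible_fderivWithin_extendCoordChange one_ne_zero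
    (IsManifold.chart_mem_maximalAtlas (n := 1) (I := 𝓡∂ 2) q)
    (IsManifold.chart_mem_maximalAtlas p) hsrc

lemma chartDeriv_eq_comp_transition (hu : ContMDiff (𝓡∂ 2) 𝓘(ℝ, E n) 1 u) (p q : M) {x : E 2}
    (hx : x ∈ (extChartAt (𝓡∂ 2) q).target)
    (hxp : (extChartAt (𝓡∂ 2) q).symm x ∈ (extChartAt (𝓡∂ 2) p).source) :
    chartDeriv u q x = chartDeriv u p (transition p q x) ∘L
      fderivWithin ℝ (transition p q) (Set.range (𝓡∂ 2)) x := by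
  have hmaps : Set.MapsTo (transition p q) (Set.range (𝓡∂ 2)) (Set.range (𝓡∂ 2)) := by
    intro y _
    simp [transition]
  have hcomp := (hasFDerivWithinAt_chartDeriv hu ((extChartAt (𝓡∂ 2) p).map_source hxp)).comp x
    (hasFDerivWithinAt_transition p q hx hxp) hmaps
  have hsource : ∀ᶠ y in 𝓝[Set.range (𝓡∂ 2)] x,
      (extChartAt (𝓡∂ 2) q).symm y ∈ (extChartAt (𝓡∂ 2) p).source :=
    (continuousAt_extChartAt_symm'' hx).continuousWithinAt.eventually
      ((isOpen_extChartAt_source p).mem_nhds hxp)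
  refine (hcomp.congr_of_eventuallyEq ?_ ?_).fderivWithin
    (uniqueDiffWithinAt_range_of_mem_target hx)
  · filter_upwards [hsource] with y hy
    simp only [transition, Function.comp_apply, (extChartAt (𝓡∂ 2) p).left_inv hy]
  · simp only [transition, Function.comp_apply, (extChartAt (𝓡∂ 2) p).left_inv hxp]

lemma exists_chartDeriv_eq_du_comp (hu : ContMDiff (𝓡∂ 2) 𝓘(ℝ, E n) 1 u) (p : M) {q : M}
    (hq : q ∈ (extChartAt (𝓡∂ 2) p).source) :
    ∃ T : E 2 ≃L[ℝ] E 2, chartDeriv u p (extChartAt (𝓡∂ 2) p q) = du u q ∘L T := by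
  have hx := (extChartAt (𝓡∂ 2) p).map_source hq
  have hxq : (extChartAt (𝓡∂ 2) p).symm (extChartAt (𝓡∂ 2) p q) ∈
      (extChartAt (𝓡∂ 2) q).source := by
    rw [(extChartAt (𝓡∂ 2) p).left_inv hq]
    exact mem_extChartAt_source q
  obtain ⟨T, hT⟩ := isInvertible_fderivWithin_transition q p hx hxq
  refine ⟨T, ?_⟩
  rw [chartDeriv_eq_comp_transition hu q p hx hxq, ← hT, transition, Function.comp_apply,
    (extChartAt (𝓡∂ 2) p).left_inv hq, du_eq_chartDeriv hu]

lemma injective_chartDeriv_iff (hu : ContMDiff (𝓡∂ 2) 𝓘(ℝ, E n) 1 u) (p : M) {q : M}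
    (hq : q ∈ (extChartAt (𝓡∂ 2) p).source) :
    Function.Injective (chartDeriv u p (extChartAt (𝓡∂ 2) p q)) ↔
      Function.Injective (du u q) := by
  obtain ⟨T, hT⟩ := exists_chartDeriv_eq_du_comp hu p hq
  rw [hT]
  exact T.toEquiv.injective_comp (du u q)

lemma range_chartDeriv (hu : ContMDiff (𝓡∂ 2) 𝓘(ℝ, E n) 1 u) (p : M) {q : M}
    (hq : q ∈ (extChartAt (𝓡∂ 2) p).source) :
    LinearMap.range (chartDeriv u p (extChartAt (𝓡∂ 2) p q)).toLinearMap = tangentPlane u q := by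
  obtain ⟨T, hT⟩ := exists_chartDeriv_eq_du_comp hu p hq
  rw [hT, tangentPlane, ContinuousLinearMap.toLinearMap_comp]
  exact LinearMap.range_comp_of_range_eq_top _ (LinearMap.range_eq_top.2 T.surjective)

lemma isOpen_setOf_injective_du (hu : ContMDiff (𝓡∂ 2) 𝓘(ℝ, E n) 1 u) :
    IsOpen {q | Function.Injective (du u q)} := by
  refine isOpen_iff_mem_nhds.2 fun p hp => ?_
  have hinj := (injective_chartDeriv_iff hu p (mem_extChartAt_source p)).2 hp
  filter_upwards [(continuousAt_chartDeriv_extChartAt hu p).eventually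
    (ContinuousLinearMap.isOpen_injective.mem_nhds hinj),
    extChartAt_source_mem_nhds (I := 𝓡∂ 2) p] with q hq hqs
  exact (injective_chartDeriv_iff hu p hqs).1 hq

end Differential

variable [MeasurableSpace M] [BorelSpace M]

lemma chartArea_eq_of_subset_source (hu : ContMDiff (𝓡∂ 2) 𝓘(ℝ, E n) 1 u) {p q : M} {A : Set M}
    (hA : MeasurableSet A) (hAp : A ⊆ (extChartAt (𝓡∂ 2) p).source)
    (hAq : A ⊆ (extChartAt (𝓡∂ 2) q).source) : chartArea u q A = chartArea u p A := by
  have hchart {p : M} (hp : A ⊆ (extChartAt (𝓡∂ 2) p).source) :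
      (extChartAt (𝓡∂ 2) p).symm ⁻¹' A ∩ (extChartAt (𝓡∂ 2) p).target =
        extChartAt (𝓡∂ 2) p '' A := by
    rw [(extChartAt (𝓡∂ 2) p).image_eq_target_inter_inv_preimage hp, Set.inter_comm]
  rw [chartArea_apply u q hA, chartArea_apply u p hA, hchart hAp]
  set S := (extChartAt (𝓡∂ 2) q).symm ⁻¹' A ∩ (extChartAt (𝓡∂ 2) q).target with hSdef
  have himage : extChartAt (𝓡∂ 2) p '' A = transition p q '' S := by
    rw [hSdef, hchart hAq, ← Set.image_comp]
    refine Set.image_congr fun a ha => ?_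
    simp only [transition, Function.comp_apply, (extChartAt (𝓡∂ 2) q).left_inv (hAq ha)]
  have hS : MeasurableSet S := measurableSet_symm_preimage_inter_target q hA
  have hinj : Set.InjOn (transition p q) S := fun x hx y hy hxy =>
    (extChartAt (𝓡∂ 2) q).symm.injOn hx.2 hy.2
      ((extChartAt (𝓡∂ 2) p).injOn (hAp hx.1) (hAp hy.1) hxy)
  rw [himage, lintegral_image_eq_lintegral_abs_det_fderiv_mul volume hS
    (fun x hx => (hasFDerivWithinAt_transition p q hx.2 (hAp hx.1)).mono
      fun y hy => extChartAt_target_subset_range q hy.2) hinj]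
  refine setLIntegral_congr_fun hS fun x hx => ?_
  rw [chartDeriv_eq_comp_transition hu p q hx.2 (hAp hx.1), jacobian_comp,
    ENNReal.ofReal_mul (abs_nonneg _)]

lemma area_le_chartArea_add_restrict (hu : ContMDiff (𝓡∂ 2) 𝓘(ℝ, E n) 1 u) (p : M) :
    area u ≤ chartArea u p + (area u).restrict (extChartAt (𝓡∂ 2) p).sourceᶜ := by
  have hsource (p : M) : MeasurableSet (extChartAt (𝓡∂ 2) p).source :=
    (isOpen_extChartAt_source p).measurableSet
  refine iSup_le fun q => Measure.le_iff.2 fun A hA => ?_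
  rw [Measure.add_apply, Measure.restrict_apply hA,
    ← measure_inter_add_sdiff A (hsource p) (μ := chartArea u q), ← Set.sdiff_eq]
  refine add_le_add ?_ (le_iSup (chartArea u) q _)
  rw [← chartArea_inter_source u q (hA.inter (hsource p)),
    chartArea_eq_of_subset_source hu ((hA.inter (hsource p)).inter (hsource q))
      (Set.inter_subset_left.trans Set.inter_subset_right) Set.inter_subset_right]
  exact measure_mono (Set.inter_subset_left.trans Set.inter_subset_left)

lemma area_apply_of_subset_source (hu : ContMDiff (𝓡∂ 2) 𝓘(ℝ, E n) 1 u) {p : M} {A : Set M}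
    (hA : MeasurableSet A) (hAp : A ⊆ (extChartAt (𝓡∂ 2) p).source) :
    area u A = chartArea u p A := by
  refine le_antisymm ((area_le_chartArea_add_restrict hu p A).trans_eq ?_)
    (le_iSup (chartArea u) p A)
  rw [Measure.add_apply, Measure.restrict_apply hA,
    (Set.disjoint_compl_right_iff_subset.2 hAp).inter_eq, measure_empty, add_zero]

lemma isLocallyFiniteMeasure_area (hu : ContMDiff (𝓡∂ 2) 𝓘(ℝ, E n) 1 u) :
    IsLocallyFiniteMeasure (area u) := by
  refine ⟨fun p => ?_⟩
  obtain ⟨S, hS, hint⟩ := (continuous_jacobian.comp_continuousOn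
    (continuousOn_chartDeriv hu p)).integrableAt_nhdsWithin (μ := volume)
      (measurableSet_extChartAt_target p) (mem_extChartAt_target p)
  obtain ⟨V, hV, hpV, hVS⟩ := mem_nhdsWithin.1 hS
  have hopen : IsOpen ((extChartAt (𝓡∂ 2) p).source ∩ extChartAt (𝓡∂ 2) p ⁻¹' V) :=
    isOpen_extChartAt_preimage' p hV
  refine ⟨_, hopen.mem_nhds ⟨mem_extChartAt_source p, hpV⟩, ?_⟩
  rw [area_apply_of_subset_source hu hopen.measurableSet Set.inter_subset_left,
    chartArea_apply u p hopen.measurableSet]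
  refine (lintegral_mono_set fun x hx => hVS ⟨?_, hx.2⟩).trans_lt hint.lintegral_lt_top
  exact (extChartAt (𝓡∂ 2) p).right_inv hx.2 ▸ hx.1.2

lemma isFiniteMeasure_area [CompactSpace M] (hu : ContMDiff (𝓡∂ 2) 𝓘(ℝ, E n) 1 u) :
    IsFiniteMeasure (area u) :=
  have := isLocallyFiniteMeasure_area hu
  inferInstance

lemma ae_injective_du [CompactSpace M] (hu : ContMDiff (𝓡∂ 2) 𝓘(ℝ, E n) 1 u) :
    ∀ᵐ q ∂area u, Function.Injective (du u q) := by
  have hclosed : IsClosed {q | ¬ Function.Injective (du u q)} :=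
    (isOpen_setOf_injective_du hu).isClosed_compl
  refine hclosed.isCompact.measure_zero_of_nhdsWithin fun p _ =>
    ⟨_, inter_mem_nhdsWithin _ (extChartAt_source_mem_nhds (I := 𝓡∂ 2) p), ?_⟩
  have hmeas := hclosed.measurableSet.inter (isOpen_extChartAt_source (I := 𝓡∂ 2) p).measurableSet
  rw [area_apply_of_subset_source hu hmeas Set.inter_subset_right, chartArea_apply u p hmeas]
  refine setLIntegral_eq_zero (measurableSet_symm_preimage_inter_target p hmeas) fun x hx => ?_
  have hiff := injective_chartDeriv_iff hu p hx.1.2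
  rw [(extChartAt (𝓡∂ 2) p).right_inv hx.2] at hiff
  simp [jacobian_eq_zero_iff.2 (mt hiff.1 hx.1.1)]

end Area

/-! ### The divergence identity for conformal vector fields -/

section RadialField

variable {V : Type*} [NormedAddCommGroup V]

/-- The square of the conformal factor of the inverse stereographic projection centred at `x₀` at
scale `s`, up to a constant: integrated over a plane through `x₀` it gives `2π`. -/
def conformalKernel (x₀ : V) (s : ℝ) (x : V) : ℝ :=
  2 * s ^ 2 / (s ^ 2 + ‖x - x₀‖ ^ 2) ^ 2

lemma conformalKernel_nonneg (x₀ : V) (s : ℝ) (x : V) : 0 ≤ conformalKernel x₀ s x := by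
  unfold conformalKernel
  positivity

lemma continuous_conformalKernel (x₀ : V) {s : ℝ} (hs : s ≠ 0) :
    Continuous (conformalKernel x₀ s) := by
  unfold conformalKernel
  fun_prop (disch := intro; positivity)

variable [InnerProductSpace ℝ V]

/-- The vector field `(x - x₀) / (s² + |x - x₀|²)`, a smooth replacement for the logarithmic
gradient field `(x - x₀) / |x - x₀|²`. -/
def radialField (x₀ : V) (s : ℝ) (x : V) : V :=
  (s ^ 2 + ‖x - x₀‖ ^ 2)⁻¹ • (x - x₀)

lemma contDiff_radialField (x₀ : V) {s : ℝ} (hs : s ≠ 0) : ContDiff ℝ 1 (radialField x₀ s) := by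
  have hsub : ContDiff ℝ 1 fun x : V => x - x₀ := contDiff_id.sub contDiff_const
  exact ((contDiff_const.add (hsub.norm_sq ℝ)).inv fun x => by positivity).smul hsub

lemma hasFDerivAt_radialField (x₀ : V) {s : ℝ} (hs : s ≠ 0) (x : V) :
    HasFDerivAt (radialField x₀ s)
      ((s ^ 2 + ‖x - x₀‖ ^ 2)⁻¹ • ContinuousLinearMap.id ℝ V -
        (2 : ℝ) • (innerSL ℝ (radialField x₀ s x)).smulRight (radialField x₀ s x)) x := by
  have hρ : s ^ 2 + ‖x - x₀‖ ^ 2 ≠ 0 := by positivity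
  have hsub : HasFDerivAt (fun x : V => x - x₀) (ContinuousLinearMap.id ℝ V) x :=
    (hasFDerivAt_id x).sub_const x₀
  refine (((hasDerivAt_inv hρ).comp_hasFDerivAt x (hsub.norm_sq.const_add (s ^ 2))).smul
    hsub).congr_fderiv ?_
  ext v : 1
  simp only [radialField, Function.comp_apply, add_apply, sub_apply, smul_apply,
    ContinuousLinearMap.id_apply, ContinuousLinearMap.smulRight_apply,
    ContinuousLinearMap.comp_apply, innerSL_apply_apply, real_inner_smul_left, smul_smul,
    smul_eq_mul, nsmul_eq_mul, Nat.cast_ofNat]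
  rw [sub_eq_add_neg (_ • v), ← neg_smul, ← inv_pow]
  congr 2
  ring

lemma trace_starProjection_comp_fderiv_radialField [FiniteDimensional ℝ V] {K : Submodule ℝ V}
    (hK : Module.finrank ℝ K = 2) (x₀ : V) {s : ℝ} (hs : s ≠ 0) (x : V) :
    LinearMap.trace ℝ V (K.starProjection ∘L fderiv ℝ (radialField x₀ s) x).toLinearMap =
      conformalKernel x₀ s x + 2 * ‖Kᗮ.starProjection (radialField x₀ s x)‖ ^ 2 := by
  set X := radialField x₀ s x with hX
  set ρ := s ^ 2 + ‖x - x₀‖ ^ 2 with hρ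
  have hρ0 : ρ ≠ 0 := by positivity
  have hcomp : (K.starProjection ∘L (ρ⁻¹ • ContinuousLinearMap.id ℝ V -
      (2 : ℝ) • (innerSL ℝ X).smulRight X)).toLinearMap =
      ρ⁻¹ • K.starProjection.toLinearMap -
        (2 : ℝ) • (innerSL ℝ X).toLinearMap.smulRight (K.starProjection X) := by
    ext v : 1
    simp
  have htrace : LinearMap.trace ℝ V K.starProjection.toLinearMap = 2 := by
    have := LinearMap.IsProj.trace (f := K.starProjection.toLinearMap)
      ⟨K.starProjection_apply_mem, fun x => Submodule.starProjection_eq_self_iff.2⟩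
    rw [this, hK, Nat.cast_ofNat]
  have hinner : (innerSL ℝ X).toLinearMap (K.starProjection X) = ‖K.starProjection X‖ ^ 2 := by
    have := K.starProjection_inner_eq_zero X _ (K.starProjection_apply_mem X)
    rwa [inner_sub_left, sub_eq_zero, real_inner_self_eq_norm_sq] at this
  have hnorm : ‖X‖ ^ 2 = (ρ⁻¹) ^ 2 * (ρ - s ^ 2) := by
    rw [hX, radialField, norm_smul, mul_pow, Real.norm_eq_abs, sq_abs, hρ, add_sub_cancel_left]
  have hsplit := K.norm_sq_eq_add_norm_sq_starProjection X
  have hkernel : conformalKernel x₀ s x = 2 * ρ⁻¹ - 2 * ((ρ⁻¹) ^ 2 * (ρ - s ^ 2)) := by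
    rw [conformalKernel, ← hρ]
    field_simp
    ring
  rw [(hasFDerivAt_radialField x₀ hs x).fderiv, hcomp, map_sub, map_smul, map_smul, htrace,
    LinearMap.trace_smulRight, hinner, hkernel, ← hnorm, smul_eq_mul, smul_eq_mul]
  linarith

end RadialField

section TangentPlane

lemma isInvertible_adjoint_comp_self {V W : Type*} [NormedAddCommGroup V]
    [InnerProductSpace ℝ V] [FiniteDimensional ℝ V] [CompleteSpace V] [NormedAddCommGroup W]
    [InnerProductSpace ℝ W] [CompleteSpace W] {D : V →L[ℝ] W} (hD : Function.Injective D) :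
    (ContinuousLinearMap.adjoint D ∘L D).IsInvertible :=
  ⟨(LinearEquiv.ofInjectiveEndo (ContinuousLinearMap.adjoint D ∘L D).toLinearMap
    (D.adjoint_comp_self_injective_iff.2 hD)).toContinuousLinearEquiv, by ext; rfl⟩

variable {n : ℕ}

lemma starProjection_range_eq {D : E 2 →L[ℝ] E n} (hD : Function.Injective D) :
    (LinearMap.range D.toLinearMap).starProjection =
      D ∘L (ContinuousLinearMap.adjoint D ∘L D).inverse ∘L ContinuousLinearMap.adjoint D := by
  ext x : 1
  refine Submodule.eq_starProjection_of_mem_of_inner_eq_zero ⟨_, rfl⟩ ?_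
  rintro _ ⟨y, rfl⟩
  rw [inner_sub_left, sub_eq_zero]
  simp only [ContinuousLinearMap.coe_coe, ContinuousLinearMap.comp_apply]
  rw [← ContinuousLinearMap.adjoint_inner_left, ← ContinuousLinearMap.adjoint_inner_left]
  congr 1
  exact ((isInvertible_adjoint_comp_self hD).self_apply_inverse _).symm

lemma continuousAt_starProjection_range {D : E 2 →L[ℝ] E n} (hD : Function.Injective D) :
    ContinuousAt (fun D : E 2 →L[ℝ] E n => (LinearMap.range D.toLinearMap).starProjection) D := by
  have hadj : Continuous fun D : E 2 →L[ℝ] E n => ContinuousLinearMap.adjoint D :=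
    ContinuousLinearMap.adjoint.continuous
  have hinv : ContinuousAt (fun D : E 2 →L[ℝ] E n =>
      (ContinuousLinearMap.adjoint D ∘L D).inverse) D :=
    ContinuousAt.comp (f := fun D : E 2 →L[ℝ] E n => ContinuousLinearMap.adjoint D ∘L D)
      ((isInvertible_adjoint_comp_self hD).contDiffAt_map_inverse (n := 0)).continuousAt
      (hadj.clm_comp continuous_id).continuousAt
  refine (continuousAt_id.clm_comp (hinv.clm_comp hadj.continuousAt)).congr ?_
  filter_upwards [ContinuousLinearMap.isOpen_injective.mem_nhds hD] with D' hD'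
  exact (starProjection_range_eq hD').symm

variable {M : Type*} [TopologicalSpace M] [ChartedSpace (EuclideanHalfSpace 2) M] {u : M → E n}

lemma finrank_tangentPlane {q : M} (hq : Function.Injective (du u q)) :
    Module.finrank ℝ (tangentPlane u q) = 2 :=
  (LinearMap.finrank_range_of_inj hq).trans finrank_euclideanSpace_fin

variable [IsManifold (𝓡∂ 2) 1 M]

lemma continuousOn_starProjection_tangentPlane (hu : ContMDiff (𝓡∂ 2) 𝓘(ℝ, E n) 1 u) :
    ContinuousOn (fun q => (tangentPlane u q).starProjection)
      {q | Function.Injective (du u q)} := by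
  intro p hp
  have hinj := (injective_chartDeriv_iff hu p (mem_extChartAt_source p)).2 hp
  refine ((ContinuousAt.comp (f := fun q => chartDeriv u p (extChartAt (𝓡∂ 2) p q))
    (continuousAt_starProjection_range hinj)
    (continuousAt_chartDeriv_extChartAt hu p)).congr ?_).continuousWithinAt
  filter_upwards [extChartAt_source_mem_nhds (I := 𝓡∂ 2) p] with q hq
  simp only [Function.comp_apply]
  congr 1
  exact range_chartDeriv hu p hq

variable [CompactSpace M] [MeasurableSpace M] [BorelSpace M]

lemma aestronglyMeasurable_starProjection_orthogonal_tangentPlane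
    (hu : ContMDiff (𝓡∂ 2) 𝓘(ℝ, E n) 1 u) {Y : M → E n} (hY : Continuous Y) :
    AEStronglyMeasurable (fun q => (tangentPlane u q)ᗮ.starProjection (Y q)) (area u) := by
  have := isFiniteMeasure_area hu
  have hcont : ContinuousOn (fun q => (tangentPlane u q)ᗮ.starProjection (Y q))
      {q | Function.Injective (du u q)} := by
    simp only [Submodule.starProjection_orthogonal_val]
    exact hY.continuousOn.sub
      ((continuousOn_starProjection_tangentPlane hu).clm_apply hY.continuousOn)
  rw [← Measure.restrict_eq_self_of_ae_mem (ae_injective_du hu)]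
  exact hcont.aestronglyMeasurable (isOpen_setOf_injective_du hu).measurableSet

end TangentPlane

section Divergence

variable {n : ℕ} {M : Type*} [TopologicalSpace M] [ChartedSpace (EuclideanHalfSpace 2) M]
  [IsManifold (𝓡∂ 2) 1 M] [CompactSpace M] [MeasurableSpace M] [BorelSpace M] {u H : M → E n}

lemma integrable_conformalKernel (hu : ContMDiff (𝓡∂ 2) 𝓘(ℝ, E n) 1 u) (x₀ : E n) {s : ℝ}
    (hs : s ≠ 0) : Integrable (fun q => conformalKernel x₀ s (u q)) (area u) := by
  have := isFiniteMeasure_area hu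
  exact ((continuous_conformalKernel x₀ hs).comp hu.continuous).integrable_of_hasCompactSupport
    (HasCompactSupport.of_compactSpace _)

/-- The conformal monotonicity formula: the term `2 |X^⊥|²` in the divergence of the radial field
`X` absorbs `X · H` up to `|H|² / 8`. -/
lemma integral_conformalKernel_le (hu : ContMDiff (𝓡∂ 2) 𝓘(ℝ, E n) 1 u)
    (hnormal : ∀ᵐ q ∂area u, H q ∈ (tangentPlane u q)ᗮ) (hdiv : DivergenceIdentity u H)
    (hH : MemLp H 2 (area u)) (x₀ : E n) {s : ℝ} (hs : s ≠ 0) :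
    ∫ q, conformalKernel x₀ s (u q) ∂area u ≤
      (∫ x in boundaryCurve u, inner ℝ (radialField x₀ s x) (boundaryConormal u x) ∂μH[1]) +
        1 / 8 * ∫ q, ‖H q‖ ^ 2 ∂area u := by
  have := isFiniteMeasure_area hu
  set Y : M → E n := fun q => radialField x₀ s (u q)
  set N : M → E n := fun q => (tangentPlane u q)ᗮ.starProjection (Y q)
  have hYc : Continuous Y := (contDiff_radialField x₀ hs).continuous.comp hu.continuous
  have hY : MemLp Y 2 (area u) :=
    hYc.memLp_of_hasCompactSupport (HasCompactSupport.of_compactSpace _)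
  have hN : MemLp N 2 (area u) :=
    hY.mono (aestronglyMeasurable_starProjection_orthogonal_tangentPlane hu hYc)
      (.of_forall fun q => Submodule.norm_starProjection_apply_le _ _)
  have hNsq : Integrable (fun q => 2 * ‖N q‖ ^ 2) (area u) :=
    (hN.integrable_norm_pow two_ne_zero).const_mul 2
  have hHsq : Integrable (fun q => 1 / 8 * ‖H q‖ ^ 2) (area u) :=
    (hH.integrable_norm_pow two_ne_zero).const_mul _
  have hYH : Integrable (fun q => inner ℝ (Y q) (H q)) (area u) :=
    (hY.norm.integrable_mul hH.norm).mono' (hY.1.inner hH.1)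
      (.of_forall fun q => norm_inner_le_norm _ _)
  have tangentialDiv_eq : ∀ᵐ q ∂area u, tangentialDiv u (radialField x₀ s) q =
      conformalKernel x₀ s (u q) + 2 * ‖N q‖ ^ 2 := by
    filter_upwards [ae_injective_du hu] with q hq
    exact trace_starProjection_comp_fderiv_radialField (finrank_tangentPlane hq) x₀ hs (u q)
  have inner_le : ∀ᵐ q ∂area u, inner ℝ (Y q) (H q) ≤ 2 * ‖N q‖ ^ 2 + 1 / 8 * ‖H q‖ ^ 2 := by
    filter_upwards [hnormal] with q hq
    have hYN : inner ℝ (Y q) (H q) = inner ℝ (N q) (H q) := by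
      rw [Submodule.inner_starProjection_left_eq_right, Submodule.starProjection_eq_self_iff.2 hq]
    rw [hYN]
    nlinarith [real_inner_le_norm (N q) (H q), sq_nonneg (4 * ‖N q‖ - ‖H q‖)]
  have hidentity := hdiv (radialField x₀ s) (contDiff_radialField x₀ hs)
  rw [integral_congr_ae tangentialDiv_eq,
    integral_add (integrable_conformalKernel hu x₀ hs) hNsq] at hidentity
  have hle := integral_mono_ae hYH (hNsq.add hHsq) inner_le
  rw [integral_add' hNsq hHsq, integral_const_mul (1 / 8 : ℝ)] at hle
  linarith

lemma setIntegral_inner_radialField_le_integral_angularSpeed {V : Type*} [NormedAddCommGroup V]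
    [InnerProductSpace ℝ V] [MeasurableSpace V] [BorelSpace V] {γ : ℝ → V}
    (hγ : ContDiff ℝ 1 γ) (hper : Function.Periodic γ 1) {ν : V → V} (hν : ∀ x, ‖ν x‖ ≤ 1)
    (hperp : ∀ t, inner ℝ (ν (γ t)) (deriv γ t) = 0) (x₀ : V) {s : ℝ} (hs : s ≠ 0) :
    ∫ x in Set.range γ, inner ℝ (radialField x₀ s x) (ν x) ∂μH[1] ≤
      ∫ t in (0 : ℝ)..1, angularSpeed γ x₀ s t := by
  have hpt (t : ℝ) : ‖deriv γ t‖ * ‖inner ℝ (radialField x₀ s (γ t)) (ν (γ t))‖ ≤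
      angularSpeed γ x₀ s t := by
    have hpos : 0 < (s ^ 2 + ‖γ t - x₀‖ ^ 2)⁻¹ := by positivity
    rw [radialField, real_inner_smul_left, norm_mul, Real.norm_of_nonneg hpos.le, angularSpeed,
      div_eq_inv_mul, mul_left_comm]
    gcongr
    exact norm_mul_abs_inner_le_wedgeNorm _ (hν _) (hperp t)
  have hint : IntegrableOn (angularSpeed γ x₀ s) (Set.Ioc 0 1) :=
    (continuous_angularSpeed hγ x₀ hs).integrableOn_Ioc
  have hnorm : ∫⁻ x in Set.range γ, ‖inner ℝ (radialField x₀ s x) (ν x)‖ₑ ∂μH[1] ≤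
      ENNReal.ofReal (∫ t in (0 : ℝ)..1, angularSpeed γ x₀ s t) := by
    rw [intervalIntegral.integral_of_le zero_le_one,
      ofReal_integral_eq_lintegral_ofReal hint (.of_forall (angularSpeed_nonneg γ x₀ s))]
    refine (lintegral_hausdorffMeasure_range_le hγ hper _).trans (lintegral_mono fun t => ?_)
    rw [← ofReal_norm, ← ofReal_norm, ← ENNReal.ofReal_mul (norm_nonneg _)]
    exact ENNReal.ofReal_le_ofReal (hpt t)
  calc ∫ x in Set.range γ, inner ℝ (radialField x₀ s x) (ν x) ∂μH[1]
      ≤ (∫⁻ x in Set.range γ, ‖inner ℝ (radialField x₀ s x) (ν x)‖ₑ ∂μH[1]).toReal := by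
        refine (Real.le_norm_self _).trans ((norm_integral_le_lintegral_norm _).trans_eq ?_)
        simp only [ofReal_norm]
    _ ≤ ∫ t in (0 : ℝ)..1, angularSpeed γ x₀ s t :=
        ENNReal.toReal_le_of_le_ofReal (intervalIntegral.integral_nonneg zero_le_one
          fun t _ => angularSpeed_nonneg γ x₀ s t) hnorm

end Divergence

/-! ### The mass of a branch point -/

section BranchKernel

/-- The pullback under `z ↦ z ^ m`, area element included, of the conformal kernel at scale `1`
centred at the origin. -/
def branchKernel (m : ℕ) (z : ℂ) : ℝ :=
  ‖(m : ℂ) * z ^ (m - 1)‖ ^ 2 * conformalKernel 0 1 (z ^ m)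

lemma branchKernel_nonneg (m : ℕ) (z : ℂ) : 0 ≤ branchKernel m z :=
  mul_nonneg (sq_nonneg _) (conformalKernel_nonneg _ _ _)

lemma branchKernel_neg (m : ℕ) (z : ℂ) : branchKernel m (-z) = branchKernel m z := by
  simp only [branchKernel, conformalKernel, sub_zero, norm_mul, norm_pow, norm_neg]

lemma hasDerivAt_neg_div_one_add_pow (m : ℕ) (r : ℝ) :
    HasDerivAt (fun r : ℝ => -(m / (1 + r ^ (2 * m))))
      (r * ((m * r ^ (m - 1)) ^ 2 * (2 / (1 + (r ^ m) ^ 2) ^ 2))) r := by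
  have hpos : 1 + r ^ (2 * m) ≠ 0 := by
    have : 0 ≤ r ^ (2 * m) := (even_two_mul m).pow_nonneg r
    positivity
  refine (((hasDerivAt_const r (m : ℝ)).div ((hasDerivAt_pow (2 * m) r).const_add 1) hpos).neg
    ).congr_deriv ?_
  rcases m with _ | k
  · simp
  · rw [← pow_mul, mul_comm (k + 1) 2, Nat.add_sub_cancel,
      show 2 * (k + 1) - 1 = 2 * k + 1 by omega]
    field_simp
    push_cast
    ring

lemma integrable_branchKernel_and_integral {m : ℕ} (hm : m ≠ 0) :
    Integrable (branchKernel m) ∧ ∫ z, branchKernel m z = 2 * Real.pi * m := by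
  set f : ℝ → ℝ := fun r => (m * r ^ (m - 1)) ^ 2 * (2 / (1 + (r ^ m) ^ 2) ^ 2) with hf
  have radial : branchKernel m = fun z => f ‖z‖ := by
    ext z
    simp [hf, branchKernel, conformalKernel]
  have tendsto_zero : Tendsto (fun r : ℝ => -(m / (1 + r ^ (2 * m)))) atTop (𝓝 0) := by
    rw [← neg_zero]
    exact (tendsto_const_nhds.div_atTop (tendsto_atTop_add_const_left _ 1
      (tendsto_pow_atTop (by omega)))).neg
  have deriv_nonneg (r : ℝ) (hr : r ∈ Set.Ioi 0) : 0 ≤ r * f r := by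
    have hr' : (0 : ℝ) < r := hr
    positivity
  have hderiv (r : ℝ) (_ : r ∈ Set.Ici 0) := hasDerivAt_neg_div_one_add_pow m r
  have hpow : (fun r : ℝ => r ^ (Module.finrank ℝ ℂ - 1) • f r) = fun r => r * f r := by
    simp [Complex.finrank_real_complex]
  rw [radial]
  constructor
  · rw [integrable_fun_norm_addHaar, hpow]
    exact integrableOn_Ioi_deriv_of_nonneg' hderiv deriv_nonneg tendsto_zero
  · rw [integral_fun_norm_addHaar volume f, hpow,
      integral_Ioi_of_hasDerivAt_of_nonneg' hderiv deriv_nonneg tendsto_zero]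
    simp [Measure.real, Complex.finrank_real_complex, hm]
    ring

lemma lintegral_branchKernel {m : ℕ} (hm : m ≠ 0) :
    ∫⁻ z, ENNReal.ofReal (branchKernel m z) = ENNReal.ofReal (2 * Real.pi * m) := by
  obtain ⟨hint, h⟩ := integrable_branchKernel_and_integral hm
  rw [← ofReal_integral_eq_lintegral_ofReal hint
    (Eventually.of_forall (branchKernel_nonneg m)), h]

lemma lintegral_comp_linearMap {U V : Type*} [NormedAddCommGroup U] [InnerProductSpace ℝ U]
    [FiniteDimensional ℝ U] [MeasurableSpace U] [BorelSpace U] [NormedAddCommGroup V]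
    [InnerProductSpace ℝ V] [FiniteDimensional ℝ V] [MeasurableSpace V] [BorelSpace V]
    (hrank : Module.finrank ℝ U = Module.finrank ℝ V) {T : U →ₗ[ℝ] V}
    (hT : Function.Injective T) (g : V → ℝ≥0∞) :
    ENNReal.ofReal T.normDet * ∫⁻ y, g (T y) = ∫⁻ w, g w := by
  let e : V ≃ₗᵢ[ℝ] U :=
    (stdOrthonormalBasis ℝ V).equiv (stdOrthonormalBasis ℝ U) (finCongr hrank.symm)
  set A : U →ₗ[ℝ] U := e.toLinearEquiv.toLinearMap ∘ₗ T with hA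
  have abs_det : |A.det| = T.normDet := by
    rw [← A.normDet_eq_abs_det, hA, LinearMap.normDet_comp_of_finrank_eq _ _ hrank,
      show e.toLinearEquiv.toLinearMap.normDet = 1 from e.toLinearIsometry.normDet_eq_one, one_mul]
  have normDet_ne_zero : T.normDet ≠ 0 := by
    rw [Ne, LinearMap.normDet_eq_zero_iff_ker_ne_bot, not_not, LinearMap.ker_eq_bot]
    exact hT
  have det_ne_zero : A.det ≠ 0 := by rwa [← abs_ne_zero, abs_det]
  have hAemb : MeasurableEmbedding A :=
    (LinearMap.isClosedEmbedding_of_injective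
      (LinearMap.ker_eq_bot.2 fun x y h => hT (e.injective h))).measurableEmbedding
  have comp_symm (y : U) : e.symm (A y) = T y := e.symm_apply_apply _
  rw [← (e.symm.measurePreserving).lintegral_comp_emb e.symm.toHomeomorph.measurableEmbedding g]
  calc ENNReal.ofReal T.normDet * ∫⁻ y, g (T y)
      = ENNReal.ofReal T.normDet * ∫⁻ x, g (e.symm x) ∂Measure.map A volume := by
        simp only [hAemb.lintegral_map, comp_symm]
    _ = ∫⁻ x, g (e.symm x) := by
        rw [Measure.map_linearMap_addHaar_eq_smul_addHaar volume det_ne_zero,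
          lintegral_smul_measure, smul_eq_mul, ← mul_assoc, abs_inv, abs_det,
          ← ENNReal.ofReal_mul T.normDet_nonneg, mul_inv_cancel₀ normDet_ne_zero,
          ENNReal.ofReal_one, one_mul]

lemma ofReal_normDet_mul_lintegral_branchKernel {T : E 2 →ₗ[ℝ] ℂ} (hT : Function.Injective T)
    {m : ℕ} (hm : m ≠ 0) :
    ENNReal.ofReal T.normDet * ∫⁻ y, ENNReal.ofReal (branchKernel m (T y)) =
      ENNReal.ofReal (2 * Real.pi * m) := by
  rw [lintegral_comp_linearMap (by simp) hT fun z => ENNReal.ofReal (branchKernel m z),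
    lintegral_branchKernel hm]

lemma two_mul_setLIntegral_pos_of_even {ι : Type*} [Fintype ι] (i : ι)
    {f : EuclideanSpace ℝ ι → ℝ≥0∞} (hf : ∀ y, f (-y) = f y) :
    2 * ∫⁻ y in {y | 0 < y i}, f y = ∫⁻ y, f y := by
  have hpos : MeasurableSet {y : EuclideanSpace ℝ ι | 0 < y i} :=
    (isOpen_lt continuous_const (by fun_prop)).measurableSet
  have neg_half : ∫⁻ y in {y | y i < 0}, f y = ∫⁻ y in {y | 0 < y i}, f y := by
    rw [← (Measure.measurePreserving_neg (volume : Measure (EuclideanSpace ℝ ι))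
      ).setLIntegral_comp_preimage_emb (Homeomorph.neg _).measurableEmbedding]
    simp [hf]
  have hyperplane_null : volume {y : EuclideanSpace ℝ ι | y i = 0} = 0 := by
    classical
    refine Measure.addHaar_submodule volume
      (LinearMap.ker (EuclideanSpace.proj i : EuclideanSpace ℝ ι →L[ℝ] ℝ).toLinearMap) fun h => ?_
    have hmem : EuclideanSpace.single i (1 : ℝ) ∈ LinearMap.ker
        (EuclideanSpace.proj i : EuclideanSpace ℝ ι →L[ℝ] ℝ).toLinearMap := h ▸ trivial
    simp at hmem
  have union_eq : {y : EuclideanSpace ℝ ι | y i < 0} ∪ {y | 0 < y i} = {y | y i = 0}ᶜ := by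
    ext y
    simp [lt_or_lt_iff_ne]
  have ae_mem : ∀ᵐ y : EuclideanSpace ℝ ι, y ∈ {y : EuclideanSpace ℝ ι | y i = 0}ᶜ :=
    compl_mem_ae_iff.2 hyperplane_null
  have disjoint : Disjoint {y : EuclideanSpace ℝ ι | y i < 0} {y | 0 < y i} :=
    Set.disjoint_left.2 fun y hy hy' => lt_asymm (Set.mem_ofPred.1 hy) (Set.mem_ofPred.1 hy')
  calc 2 * ∫⁻ y in {y | 0 < y i}, f y
      = ∫⁻ y in {y | y i < 0} ∪ {y | 0 < y i}, f y := by
        rw [lintegral_union hpos disjoint, neg_half, two_mul]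
    _ = ∫⁻ y, f y := by rw [union_eq, Measure.restrict_eq_self_of_ae_mem ae_mem]

lemma ofReal_normDet_mul_setLIntegral_pos_branchKernel {T : E 2 →ₗ[ℝ] ℂ}
    (hT : Function.Injective T) {m : ℕ} (hm : m ≠ 0) :
    ENNReal.ofReal T.normDet * ∫⁻ y in {y | 0 < y 0}, ENNReal.ofReal (branchKernel m (T y)) =
      ENNReal.ofReal (Real.pi * m) := by
  have even (y : E 2) :
      ENNReal.ofReal (branchKernel m (T (-y))) = ENNReal.ofReal (branchKernel m (T y)) := by
    rw [map_neg, branchKernel_neg]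
  have h := ofReal_normDet_mul_lintegral_branchKernel hT hm
  rw [← two_mul_setLIntegral_pos_of_even 0 even, mul_left_comm, mul_assoc 2 Real.pi,
    ENNReal.ofReal_mul zero_le_two, ENNReal.ofReal_ofNat] at h
  exact (ENNReal.mul_right_inj two_ne_zero ENNReal.ofNat_ne_top).1 h

end BranchKernel

/-! ### Local models -/

section BlowUp

lemma conformalKernel_eq_inv_sq_mul {V : Type*} [NormedAddCommGroup V] [NormedSpace ℝ V]
    (x₀ x : V) {c : ℝ} (hc : c ≠ 0) :
    conformalKernel x₀ c x = (c ^ 2)⁻¹ * conformalKernel 0 1 (c⁻¹ • (x - x₀)) := by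
  simp only [conformalKernel, sub_zero, norm_smul, norm_inv, mul_pow, inv_pow, Real.norm_eq_abs,
    sq_abs]
  field_simp

lemma nhdsGT_zero_le_map_pow {m : ℕ} (hm : m ≠ 0) :
    𝓝[>] (0 : ℝ) ≤ map (fun σ : ℝ => σ ^ m) (𝓝[>] 0) := by
  have hinv : 0 < (m : ℝ)⁻¹ := by positivity
  refine le_map_of_right_inverse (mba := fun s : ℝ => s ^ (m : ℝ)⁻¹) ?_ ?_
  · filter_upwards [self_mem_nhdsWithin] with s hs
    exact Real.rpow_inv_natCast_pow (le_of_lt hs) hm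
  · refine tendsto_nhdsWithin_iff.2 ⟨?_, eventually_nhdsWithin_of_forall fun s hs =>
      Real.rpow_pos_of_pos hs _⟩
    have h := (Real.continuousAt_rpow_const 0 _ (.inr hinv.le)).tendsto.mono_left
      (nhdsWithin_le_nhds (s := Set.Ioi (0 : ℝ)))
    rwa [Real.zero_rpow hinv.ne'] at h

lemma tendsto_add_smul {F : Type*} [NormedAddCommGroup F] [NormedSpace ℝ F] {R : Set F} {x₀ y : F}
    {l : Filter ℝ} (hl : l ≤ 𝓝[≠] 0) (hy : ∀ᶠ σ in l, x₀ + σ • y ∈ R) :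
    Tendsto (fun σ : ℝ => x₀ + σ • y) l (𝓝[R] x₀) := by
  refine tendsto_nhdsWithin_iff.2 ⟨?_, hy⟩
  have : Continuous fun σ : ℝ => x₀ + σ • y := by fun_prop
  simpa using (this.tendsto 0).mono_left (hl.trans nhdsWithin_le_nhds)

variable {F : Type*} [NormedAddCommGroup F] [NormedSpace ℝ F] [FiniteDimensional ℝ F]
  [MeasurableSpace F] [BorelSpace F] (μ : Measure F) [μ.IsAddHaarMeasure]

lemma lintegral_comp_add_smul (g : F → ℝ≥0∞) (x₀ : F) {σ : ℝ} (hσ : 0 < σ) :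
    ∫⁻ y, ENNReal.ofReal (σ ^ Module.finrank ℝ F) * g (x₀ + σ • y) ∂μ = ∫⁻ x, g x ∂μ := by
  have hpow : 0 < σ ^ Module.finrank ℝ F := pow_pos hσ _
  have hemb : MeasurableEmbedding (σ • · : F → F) :=
    (Homeomorph.smulOfNeZero σ hσ.ne').measurableEmbedding
  rw [lintegral_const_mul' _ _ ENNReal.ofReal_ne_top,
    ← hemb.lintegral_map (fun x => g (x₀ + x)), Measure.map_addHaar_smul μ hσ.ne',
    lintegral_smul_measure, lintegral_add_left_eq_self, smul_eq_mul, ← mul_assoc,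
    ← ENNReal.ofReal_mul hpow.le, abs_inv, abs_of_pos hpow, mul_inv_cancel₀ hpow.ne',
    ENNReal.ofReal_one, one_mul]

lemma setLIntegral_le_liminf_of_blowUp {g : ℝ → F → ℝ≥0∞} (hg : ∀ σ, Measurable (g σ)) (x₀ : F)
    {C : Set F} (hC : MeasurableSet C) {φ : F → ℝ≥0∞}
    (hφ : ∀ y ∈ C, φ y ≤
      liminf (fun σ => ENNReal.ofReal (σ ^ Module.finrank ℝ F) * g σ (x₀ + σ • y)) (𝓝[>] 0)) :
    ∫⁻ y in C, φ y ∂μ ≤ liminf (fun σ => ∫⁻ x, g σ x ∂μ) (𝓝[>] 0) := by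
  have hmeas (σ : ℝ) :
      Measurable fun y => ENNReal.ofReal (σ ^ Module.finrank ℝ F) * g σ (x₀ + σ • y) :=
    ((hg σ).comp (by fun_prop)).const_mul _
  calc ∫⁻ y in C, φ y ∂μ
      ≤ ∫⁻ y in C, liminf (fun σ => ENNReal.ofReal (σ ^ Module.finrank ℝ F) *
          g σ (x₀ + σ • y)) (𝓝[>] 0) ∂μ := setLIntegral_mono' hC hφ
    _ ≤ liminf (fun σ => ∫⁻ y in C, ENNReal.ofReal (σ ^ Module.finrank ℝ F) *
          g σ (x₀ + σ • y) ∂μ) (𝓝[>] 0) := lintegral_liminf_le hmeas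
    _ ≤ liminf (fun σ => ∫⁻ x, g σ x ∂μ) (𝓝[>] 0) := by
        refine liminf_le_liminf (eventually_nhdsWithin_of_forall fun σ hσ => ?_)
        exact (setLIntegral_le_lintegral _ _).trans (lintegral_comp_add_smul μ (g σ) x₀ hσ).le

end BlowUp

section LocalModel

variable {W : Type*} [NormedAddCommGroup W] [InnerProductSpace ℝ W]

lemma measurable_indicator_normDet_mul_conformalKernel {v : E 2 → W} {R V : Set (E 2)}
    (hVm : MeasurableSet V) (hv : ContinuousOn v V) (hDv : ContinuousOn (fderivWithin ℝ v R) V)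
    (x₀ : W) (s : ℝ) :
    Measurable (V.indicator fun x =>
      ENNReal.ofReal ((fderivWithin ℝ v R x).normDet * conformalKernel x₀ s (v x))) := by
  classical
  rcases eq_or_ne s 0 with rfl | hs
  · simp [conformalKernel]
  · rw [← Set.piecewise_eq_indicator]
    refine ContinuousOn.measurable_piecewise (ENNReal.continuous_ofReal.comp_continuousOn ?_)
      continuousOn_const hVm
    exact (continuous_normDet.comp_continuousOn hDv).mul
      ((continuous_conformalKernel _ hs).comp_continuousOn hv)

/-- In the coordinate `ζ`, the map `v` is `(ζ ^ m, o(|ζ| ^ m))` near `x₀`, up to a rigid motion;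
`P` embeds the factor `ℂ` of the target. -/
structure IsLocalModel (v : E 2 → W) (R : Set (E 2)) (x₀ : E 2) (m : ℕ) (ζ : E 2 → ℂ)
    (P : ℂ →ₗᵢ[ℝ] W) : Prop where
  contDiff : ContDiffWithinAt ℝ 1 ζ R x₀
  zero : ζ x₀ = 0
  injective : Function.Injective (fderivWithin ℝ ζ R x₀)
  normal : ∀ᶠ x in 𝓝[R] x₀, ∀ w, inner ℝ (P w) (v x - v x₀ - P (ζ x ^ m)) = 0
  isLittleO : (fun x => v x - v x₀ - P (ζ x ^ m)) =o[𝓝[R] x₀] fun x => ‖ζ x‖ ^ m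

namespace IsLocalModel

variable {v : E 2 → W} {R : Set (E 2)} {x₀ : E 2} {m : ℕ} {ζ : E 2 → ℂ} {P : ℂ →ₗᵢ[ℝ] W}

lemma hasFDerivWithinAt (h : IsLocalModel v R x₀ m ζ P) :
    HasFDerivWithinAt ζ (fderivWithin ℝ ζ R x₀) R x₀ :=
  (h.contDiff.differentiableWithinAt one_ne_zero).hasFDerivWithinAt

lemma tendsto_inv_smul (h : IsLocalModel v R x₀ m ζ P) {l : Filter ℝ} (hl : l ≤ 𝓝[≠] 0) {y : E 2}
    (hy : ∀ᶠ σ in l, x₀ + σ • y ∈ R) :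
    Tendsto (fun σ : ℝ => σ⁻¹ • ζ (x₀ + σ • y)) l (𝓝 (fderivWithin ℝ ζ R x₀ y)) := by
  have hzero : Tendsto (fun σ : ℝ => σ • y) l (𝓝 0) := by
    have : Continuous fun σ : ℝ => σ • y := by fun_prop
    simpa using (this.tendsto 0).mono_left (hl.trans nhdsWithin_le_nhds)
  have hone : Tendsto (fun σ : ℝ => σ⁻¹ • σ • y) l (𝓝 y) := by
    refine tendsto_const_nhds.congr'
      ((show ∀ᶠ σ in l, σ ∈ ({0}ᶜ : Set ℝ) from hl self_mem_nhdsWithin).mono fun σ hσ => ?_)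
    exact (inv_smul_smul₀ hσ y).symm
  simpa [h.zero] using h.hasFDerivWithinAt.lim hzero hy hone

lemma tendsto_inv_pow_smul_sub (h : IsLocalModel v R x₀ m ζ P) {l : Filter ℝ} (hl : l ≤ 𝓝[≠] 0)
    {y : E 2} (hy : ∀ᶠ σ in l, x₀ + σ • y ∈ R) :
    Tendsto (fun σ : ℝ => (σ ^ m)⁻¹ • (v (x₀ + σ • y) - v x₀)) l
      (𝓝 (P (fderivWithin ℝ ζ R x₀ y ^ m))) := by
  set T := fderivWithin ℝ ζ R x₀
  have main_part : Tendsto (fun σ : ℝ => (σ ^ m)⁻¹ • P (ζ (x₀ + σ • y) ^ m)) l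
      (𝓝 (P (T y ^ m))) := by
    refine ((P.continuous.tendsto _).comp ((h.tendsto_inv_smul hl hy).pow m)).congr fun σ => ?_
    simp only [Function.comp_apply, smul_pow, inv_pow, map_smul]
  have remainder : Tendsto (fun σ : ℝ => (σ ^ m)⁻¹ •
      (v (x₀ + σ • y) - v x₀ - P (ζ (x₀ + σ • y) ^ m))) l (𝓝 0) := by
    have hO : (fun σ : ℝ => ‖σ⁻¹ • ζ (x₀ + σ • y)‖ ^ m) =O[l] fun _ => (1 : ℝ) :=
      ((h.tendsto_inv_smul hl hy).norm.pow m).isBigO_one ℝ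
    have ho := (Asymptotics.isBigO_refl (fun σ : ℝ => (σ ^ m)⁻¹) l).smul_isLittleO
      (h.isLittleO.comp_tendsto (tendsto_add_smul hl hy))
    refine (Asymptotics.isLittleO_one_iff ℝ).1 (ho.trans_isBigO (.trans ?_ hO))
    refine Asymptotics.IsBigO.of_bound 1 (Eventually.of_forall fun σ => ?_)
    simp [mul_pow]
  simpa [← smul_add] using main_part.add remainder

lemma isBigO_sub (h : IsLocalModel v R x₀ m ζ P) :
    (fun x => v x - v x₀) =O[𝓝[R] x₀] fun x => ‖ζ x‖ ^ m := by
  have hP : (fun x => P (ζ x ^ m)) =O[𝓝[R] x₀] fun x => ‖ζ x‖ ^ m :=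
    Asymptotics.IsBigO.of_bound 1 (Eventually.of_forall fun x => by simp)
  simpa using h.isLittleO.isBigO.add hP

lemma hasFDerivWithinAt_zero (h : IsLocalModel v R x₀ m ζ P) (hm : 2 ≤ m) :
    HasFDerivWithinAt v (0 : E 2 →L[ℝ] W) R x₀ := by
  have hζ : ζ =O[𝓝[R] x₀] fun x => x - x₀ := by
    simpa [h.zero] using h.hasFDerivWithinAt.isBigO_sub
  rw [hasFDerivWithinAt_iff_isLittleO]
  simpa using (h.isBigO_sub.trans (hζ.norm_norm.pow m)).trans_isLittleO
    ((Asymptotics.isLittleO_pow_sub_sub x₀ hm).mono nhdsWithin_le_nhds)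

variable [CompleteSpace W]

lemma eventually_adjoint_sub_eq_pow (h : IsLocalModel v R x₀ m ζ P) :
    ∀ᶠ x in 𝓝[R] x₀, P.toContinuousLinearMap.adjoint (v x - v x₀) = ζ x ^ m := by
  filter_upwards [h.normal] with x hx
  refine ext_inner_left ℝ fun w => ?_
  have hP : P.toContinuousLinearMap w = P w := rfl
  rw [ContinuousLinearMap.adjoint_inner_right, hP, ← P.inner_map_map, ← sub_eq_zero,
    ← inner_sub_right, hx w]

lemma eventually_mul_normDet_le (h : IsLocalModel v R x₀ m ζ P) (hR : UniqueDiffOn ℝ R)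
    (hx₀ : x₀ ∈ R) (hv : ∀ᶠ x in 𝓝[R] x₀, DifferentiableWithinAt ℝ v R x) :
    ∀ᶠ x in 𝓝[R] x₀, ‖(m : ℂ) * ζ x ^ (m - 1)‖ ^ 2 * (fderivWithin ℝ ζ R x).normDet ≤
      (fderivWithin ℝ v R x).normDet := by
  set Q := P.toContinuousLinearMap.adjoint with hQ
  have norm_Q_le : ‖Q‖ ≤ 1 := by
    rw [hQ, LinearIsometryEquiv.norm_map]
    exact P.norm_toContinuousLinearMap_le
  have hζ : ∀ᶠ x in 𝓝[R] x₀, ContDiffWithinAt ℝ 1 ζ R x := by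
    simpa only [Set.insert_eq_of_mem hx₀] using h.contDiff.eventually (by simp)
  filter_upwards [hv, hζ, h.eventually_adjoint_sub_eq_pow,
    eventually_eventually_nhdsWithin.2 h.eventually_adjoint_sub_eq_pow, self_mem_nhdsWithin]
    with x hvx hζx heq heq' hxR
  have hζ' := (hζx.differentiableWithinAt one_ne_zero).hasFDerivWithinAt
  have deriv_comp : HasFDerivWithinAt (fun x => ζ x ^ m) (Q ∘L fderivWithin ℝ v R x) R x :=
    (Q.hasFDerivAt.comp_hasFDerivWithinAt x (hvx.hasFDerivWithinAt.sub_const (v x₀))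
      ).congr_of_eventuallyEq (heq'.mono fun y hy => hy.symm) heq.symm
  have comp_eq_smul : Q.toLinearMap ∘ₗ (fderivWithin ℝ v R x).toLinearMap =
      ((m : ℂ) * ζ x ^ (m - 1)) • (fderivWithin ℝ ζ R x).toLinearMap := by
    rw [← nsmul_eq_mul]
    exact congrArg ContinuousLinearMap.toLinearMap ((hR x hxR).eq deriv_comp (hζ'.pow m))
  rw [← normDet_smul_complex, ← comp_eq_smul]
  exact normDet_comp_le norm_Q_le _

lemma ofReal_normDet_mul_branchKernel_le_liminf (h : IsLocalModel v R x₀ m ζ P)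
    (hR : UniqueDiffOn ℝ R) (hx₀ : x₀ ∈ R)
    (hv : ∀ᶠ x in 𝓝[R] x₀, DifferentiableWithinAt ℝ v R x) (hm : m ≠ 0) {y : E 2}
    (hy : ∀ᶠ σ in 𝓝[>] (0 : ℝ), x₀ + σ • y ∈ R) :
    ENNReal.ofReal ((fderivWithin ℝ ζ R x₀).normDet * branchKernel m (fderivWithin ℝ ζ R x₀ y)) ≤
      liminf (fun σ : ℝ => ENNReal.ofReal (σ ^ 2 * ((fderivWithin ℝ v R (x₀ + σ • y)).normDet *
        conformalKernel (v x₀) (σ ^ m) (v (x₀ + σ • y))))) (𝓝[>] 0) := by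
  set T := fderivWithin ℝ ζ R x₀
  have hl : 𝓝[>] (0 : ℝ) ≤ 𝓝[≠] 0 := nhdsGT_le_nhdsNE 0
  have hray := tendsto_add_smul hl hy
  set G : ℝ → ℝ := fun σ => (fderivWithin ℝ ζ R (x₀ + σ • y)).normDet *
    (‖(m : ℂ) * (σ⁻¹ • ζ (x₀ + σ • y)) ^ (m - 1)‖ ^ 2 *
      conformalKernel 0 1 ((σ ^ m)⁻¹ • (v (x₀ + σ • y) - v x₀))) with hG
  have tendsto_G : Tendsto G (𝓝[>] 0) (𝓝 (T.normDet * branchKernel m (T y))) := by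
    have continuous_deriv : ContinuousWithinAt (fderivWithin ℝ ζ R) R x₀ :=
      (h.contDiff.fderivWithin_right (m := 0) hR le_rfl hx₀).continuousWithinAt
    have kernel_eq : conformalKernel 0 1 (P (T y ^ m)) = conformalKernel 0 1 (T y ^ m) := by
      simp only [conformalKernel, sub_zero, P.norm_map]
    refine ((continuous_normDet.tendsto _).comp (continuous_deriv.tendsto.comp hray)).mul ?_
    rw [branchKernel, ← kernel_eq]
    exact ((((h.tendsto_inv_smul hl hy).pow _).const_mul _).norm.pow 2).mul
      (((continuous_conformalKernel _ one_ne_zero).tendsto _).comp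
        (h.tendsto_inv_pow_smul_sub hl hy))
  rw [← (ENNReal.tendsto_ofReal tendsto_G).liminf_eq]
  refine liminf_le_liminf ?_
  filter_upwards [hray.eventually (h.eventually_mul_normDet_le hR hx₀ hv), self_mem_nhdsWithin]
    with σ hle hσ
  have hσ' : σ ≠ 0 := ne_of_gt hσ
  obtain ⟨k, rfl⟩ := Nat.exists_eq_succ_of_ne_zero hm
  refine ENNReal.ofReal_le_ofReal ?_
  calc G σ = σ ^ 2 * (‖((k + 1 : ℕ) : ℂ) * ζ (x₀ + σ • y) ^ (k + 1 - 1)‖ ^ 2 *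
        (fderivWithin ℝ ζ R (x₀ + σ • y)).normDet *
        conformalKernel (v x₀) (σ ^ (k + 1)) (v (x₀ + σ • y))) := by
        rw [conformalKernel_eq_inv_sq_mul _ _ (pow_ne_zero _ hσ')]
        simp only [hG, smul_pow, norm_mul, norm_smul, norm_pow, norm_inv, Real.norm_eq_abs,
          Nat.succ_eq_add_one, Nat.add_sub_cancel, mul_pow, inv_pow, ← pow_mul, mul_comm k 2,
          (even_two_mul k).pow_abs]
        field_simp
        ring
    _ ≤ _ := by
        gcongr
        exact conformalKernel_nonneg _ _ _

lemma mul_setLIntegral_branchKernel_le_liminf (h : IsLocalModel v R x₀ m ζ P)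
    (hR : UniqueDiffOn ℝ R) (hx₀ : x₀ ∈ R) (hm : m ≠ 0) {V : Set (E 2)} (hVm : MeasurableSet V)
    (hVR : V ⊆ R) (hV : V ∈ 𝓝[R] x₀) (hv : ∀ x ∈ V, DifferentiableWithinAt ℝ v R x)
    (hDv : ContinuousOn (fderivWithin ℝ v R) V) {C : Set (E 2)} (hC : MeasurableSet C)
    (hcone : ∀ y ∈ C, ∀ᶠ σ in 𝓝[>] (0 : ℝ), x₀ + σ • y ∈ R) :
    ENNReal.ofReal (fderivWithin ℝ ζ R x₀).normDet *
        ∫⁻ y in C, ENNReal.ofReal (branchKernel m (fderivWithin ℝ ζ R x₀ y)) ≤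
      liminf (fun s => ∫⁻ x in V, ENNReal.ofReal ((fderivWithin ℝ v R x).normDet *
        conformalKernel (v x₀) s (v x))) (𝓝[>] 0) := by
  let f (s : ℝ) (x : E 2) : ℝ≥0∞ :=
    ENNReal.ofReal ((fderivWithin ℝ v R x).normDet * conformalKernel (v x₀) s (v x))
  have measurable_f (s : ℝ) : Measurable (V.indicator (f s)) :=
    measurable_indicator_normDet_mul_conformalKernel hVm
      (fun x hx => (hv x hx).continuousWithinAt.mono hVR) hDv (v x₀) s
  have le_liminf : ∀ y ∈ C, ENNReal.ofReal ((fderivWithin ℝ ζ R x₀).normDet *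
      branchKernel m (fderivWithin ℝ ζ R x₀ y)) ≤
      liminf (fun σ : ℝ => ENNReal.ofReal (σ ^ Module.finrank ℝ (E 2)) *
        V.indicator (f (σ ^ m)) (x₀ + σ • y)) (𝓝[>] 0) := by
    intro y hy
    refine (h.ofReal_normDet_mul_branchKernel_le_liminf hR hx₀ (eventually_of_mem hV hv) hm
      (hcone y hy)).trans_eq (liminf_congr ?_)
    filter_upwards [(tendsto_add_smul (nhdsGT_le_nhdsNE 0) (hcone y hy)).eventually_mem hV]
      with σ hσ
    rw [Set.indicator_of_mem hσ, finrank_euclideanSpace_fin, ENNReal.ofReal_mul (sq_nonneg σ)]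
  calc ENNReal.ofReal (fderivWithin ℝ ζ R x₀).normDet *
        ∫⁻ y in C, ENNReal.ofReal (branchKernel m (fderivWithin ℝ ζ R x₀ y))
      = ∫⁻ y in C, ENNReal.ofReal ((fderivWithin ℝ ζ R x₀).normDet *
          branchKernel m (fderivWithin ℝ ζ R x₀ y)) := by
        rw [← lintegral_const_mul' _ _ ENNReal.ofReal_ne_top]
        simp only [ENNReal.ofReal_mul (LinearMap.normDet_nonneg _)]
    _ ≤ liminf (fun σ => ∫⁻ x, V.indicator (f (σ ^ m)) x) (𝓝[>] 0) :=
        setLIntegral_le_liminf_of_blowUp volume (fun σ => measurable_f (σ ^ m)) x₀ hC le_liminf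
    _ = liminf (fun σ => ∫⁻ x in V, f (σ ^ m) x) (𝓝[>] 0) := by
        simp only [lintegral_indicator hVm]
    _ ≤ liminf (fun s => ∫⁻ x in V, f s x) (𝓝[>] 0) :=
        liminf_le_liminf_of_le (u := fun s => ∫⁻ x in V, f s x) (nhdsGT_zero_le_map_pow hm)

end IsLocalModel

lemma exists_linearIsometry_range_eq {G : Type*} [NormedAddCommGroup G] [InnerProductSpace ℝ G]
    [FiniteDimensional ℝ G] (K : Submodule ℝ W) [FiniteDimensional ℝ K]
    (h : Module.finrank ℝ G = Module.finrank ℝ K) :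
    ∃ P : G →ₗᵢ[ℝ] W, LinearMap.range P.toLinearMap = K := by
  let e : G ≃ₗᵢ[ℝ] K := (stdOrthonormalBasis ℝ G).equiv (stdOrthonormalBasis ℝ K) (finCongr h)
  refine ⟨K.subtypeₗᵢ.comp e.toLinearIsometry, ?_⟩
  have : (K.subtypeₗᵢ.comp e.toLinearIsometry).toLinearMap =
      K.subtype ∘ₗ e.toLinearEquiv.toLinearMap := rfl
  rw [this, LinearEquiv.range_comp, K.range_subtype]

lemma exists_isLocalModel_one [CompleteSpace W] {v : E 2 → W} {R : Set (E 2)} {x₀ : E 2}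
    (hR : UniqueDiffWithinAt ℝ R x₀) (hv : ContDiffWithinAt ℝ 1 v R x₀)
    (hinj : Function.Injective (fderivWithin ℝ v R x₀)) :
    ∃ ζ P, IsLocalModel v R x₀ 1 ζ P := by
  set D := fderivWithin ℝ v R x₀
  have hD : HasFDerivWithinAt v D R x₀ :=
    (hv.differentiableWithinAt one_ne_zero).hasFDerivWithinAt
  obtain ⟨P, range_P⟩ := exists_linearIsometry_range_eq (G := ℂ) (LinearMap.range D.toLinearMap)
    (by rw [LinearMap.finrank_range_of_inj hinj]; simp)
  set Q := P.toContinuousLinearMap.adjoint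
  have Q_comp_P (w : ℂ) : Q (P w) = w := DFunLike.congr_fun
    ((ContinuousLinearMap.norm_map_iff_adjoint_comp_self P.toContinuousLinearMap).1 P.norm_map) w
  have P_Q_D (y : E 2) : P (Q (D y)) = D y := by
    obtain ⟨w, hw⟩ : D y ∈ LinearMap.range P.toLinearMap := range_P ▸ ⟨y, rfl⟩
    rw [← show P w = D y from hw, Q_comp_P]
  have hζ : HasFDerivWithinAt (fun x => Q (v x - v x₀)) (Q ∘L D) R x₀ :=
    Q.hasFDerivAt.comp_hasFDerivWithinAt x₀ (hD.sub_const (v x₀))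
  have injective_QD : Function.Injective (Q ∘L D) := fun a b hab => hinj <| by
    rw [← P_Q_D a, ← P_Q_D b]
    exact congrArg P hab
  refine ⟨fun x => Q (v x - v x₀), P,
    Q.contDiff.comp_contDiffWithinAt (hv.sub contDiffWithinAt_const), by simp, ?_, ?_, ?_⟩
  · rwa [hζ.fderivWithin hR]
  · refine Eventually.of_forall fun x w => ?_
    have hP (w : ℂ) (y : W) : inner ℝ (P w) y = inner ℝ w (Q y) :=
      (ContinuousLinearMap.adjoint_inner_right P.toContinuousLinearMap w y).symm
    rw [hP, map_sub, pow_one, Q_comp_P, sub_self, inner_zero_right]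
  · have isBigO_sub : (fun x => x - x₀) =O[𝓝[R] x₀] fun x => ‖Q (v x - v x₀)‖ ^ 1 := by
      simpa using (hζ.isTheta_sub
        ((Q ∘L D).toLinearMap.isClosedEmbedding_of_injective
          (LinearMap.ker_eq_bot.2 injective_QD)).isInducing).2
    have remainder : (fun x => (ContinuousLinearMap.id ℝ W - P.toContinuousLinearMap ∘L Q)
        (v x - v x₀ - D (x - x₀))) =o[𝓝[R] x₀] fun x => x - x₀ :=
      (ContinuousLinearMap.isBigO_comp _ _ _).trans_isLittleO hD.isLittleO
    refine (remainder.congr_left fun x => ?_).trans_isBigO isBigO_sub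
    have := P_Q_D (x - x₀)
    simp only [sub_apply, ContinuousLinearMap.id_apply, ContinuousLinearMap.comp_apply,
      LinearIsometry.coe_toContinuousLinearMap, map_sub Q (v x - v x₀), map_sub P, this, pow_one]
    abel

end LocalModel

/-! ### Densities -/

section Order

variable {n : ℕ} {M : Type*} [TopologicalSpace M] [ChartedSpace (EuclideanHalfSpace 2) M]
  {u : M → E n} {q : M} {m : ℕ}

/-- `u` has order `m` at `q`: it has a local model of order `m` in the preferred chart at `q`.
Immersed points have order `1`, branch points have order at least `2`. -/
def HasOrder (u : M → E n) (q : M) (m : ℕ) : Prop :=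
  ∃ ζ P, IsLocalModel (u ∘ (extChartAt (𝓡∂ 2) q).symm) (Set.range (𝓡∂ 2)) (extChartAt (𝓡∂ 2) q q)
    m ζ P

lemma extChartAt_self_mem_range (q : M) : extChartAt (𝓡∂ 2) q q ∈ Set.range (𝓡∂ 2) :=
  extChartAt_target_subset_range q (mem_extChartAt_target q)

lemma extChartAt_self_apply_zero_of_boundary (hq : q ∈ (𝓡∂ 2).boundary M) :
    extChartAt (𝓡∂ 2) q q 0 = 0 := by
  have h : extChartAt (𝓡∂ 2) q q ∈ frontier (Set.range (𝓡∂ 2)) := hq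
  rw [frontier_range_modelWithCornersEuclideanHalfSpace] at h
  exact h.symm

lemma HasOrder.du_eq_zero (hu : ContMDiff (𝓡∂ 2) 𝓘(ℝ, E n) 1 u) (h : HasOrder u q m)
    (hm : 2 ≤ m) : du u q = 0 := by
  obtain ⟨ζ, P, h⟩ := h
  rw [du_eq_chartDeriv hu]
  exact (h.hasFDerivWithinAt_zero hm).fderivWithin
    ((𝓡∂ 2).uniqueDiffOn _ (extChartAt_self_mem_range q))

lemma IsBranchPoint.exists_hasOrder (hq : IsBranchPoint u q) : ∃ m, 2 ≤ m ∧ HasOrder u q m := by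
  obtain ⟨m, z, P, f, hm, hz, hz0, hinj, horth, hf, hu⟩ := hq
  have hsymm : Tendsto (extChartAt (𝓡∂ 2) q).symm
      (𝓝[Set.range (𝓡∂ 2)] (extChartAt (𝓡∂ 2) q q)) (𝓝 q) :=
    (map_extChartAt_symm_nhdsWithin_range q).le
  have remainder_eq : ∀ᶠ x in 𝓝[Set.range (𝓡∂ 2)] (extChartAt (𝓡∂ 2) q q),
      (u ∘ (extChartAt (𝓡∂ 2) q).symm) x -
        (u ∘ (extChartAt (𝓡∂ 2) q).symm) (extChartAt (𝓡∂ 2) q q) -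
        P ((z ∘ (extChartAt (𝓡∂ 2) q).symm) x ^ m) = f ((z ∘ (extChartAt (𝓡∂ 2) q).symm) x) := by
    filter_upwards [hsymm.eventually hu] with x hx
    simp only [Function.comp_apply, extChartAt_to_inv, hx]
    abel
  refine ⟨m, hm, z ∘ (extChartAt (𝓡∂ 2) q).symm, P, (contMDiffAt_iff.1 hz).2, ?_, ?_, ?_, ?_⟩
  · simp only [Function.comp_apply, extChartAt_to_inv, hz0]
  · exact (hz.mdifferentiableAt one_ne_zero).mfderiv ▸ hinj
  · filter_upwards [remainder_eq] with x hx w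
    rw [hx]
    exact horth _ _
  · have hz_tendsto := hz.continuousAt.tendsto.comp hsymm
    rw [hz0] at hz_tendsto
    exact (hf.comp_tendsto hz_tendsto).congr' (remainder_eq.mono fun x hx => hx.symm)
      EventuallyEq.rfl

variable [IsManifold (𝓡∂ 2) 1 M]

lemma hasOrder_one_of_injective (hu : ContMDiff (𝓡∂ 2) 𝓘(ℝ, E n) 1 u)
    (hq : Function.Injective (du u q)) : HasOrder u q 1 :=
  exists_isLocalModel_one ((𝓡∂ 2).uniqueDiffOn _ (extChartAt_self_mem_range q))
    ((contDiffOn_comp_extChartAt_symm hu q _ (mem_extChartAt_target q)).mono_of_mem_nhdsWithin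
      (extChartAt_target_mem_nhdsWithin q))
    (by rwa [du_eq_chartDeriv hu] at hq)

lemma IsBranchedImmersion.exists_hasOrder (hu : IsBranchedImmersion u) (q : M) :
    ∃ m ≠ 0, HasOrder u q m := by
  rcases hu.immersed_or_branch q with hinj | hbranch
  · exact ⟨1, one_ne_zero, hasOrder_one_of_injective hu.contMDiff hinj⟩
  · obtain ⟨m, hm, h⟩ := hbranch.exists_hasOrder
    exact ⟨m, by lia, h⟩

end Order

section Density

variable {n : ℕ} {M : Type*} [TopologicalSpace M] [ChartedSpace (EuclideanHalfSpace 2) M]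
  [MeasurableSpace M] {u : M → E n} {q : M} {m : ℕ}

/-- The part of the surface near `q` contributes at least `c` to the integral of the conformal
kernel centred at `u q`, as the scale tends to zero. -/
def DensityGE (u : M → E n) (q : M) (c : ℝ) : Prop :=
  ∀ U ∈ 𝓝 q, ENNReal.ofReal c ≤ liminf (fun s =>
    ∫⁻ q' in U, ENNReal.ofReal (conformalKernel (u q) s (u q')) ∂area u) (𝓝[>] (0 : ℝ))

lemma DensityGE.mono {c c' : ℝ} (h : DensityGE u q c) (hc : c' ≤ c) : DensityGE u q c' :=
  fun U hU => (ENNReal.ofReal_le_ofReal hc).trans (h U hU)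

/-- The integrals over the surface of the conformal kernels centred at `x` are at most `B`, at every
scale. -/
def KernelLE (u : M → E n) (x : E n) (B : ℝ) : Prop :=
  ∀ s > 0, Integrable (fun q => conformalKernel x s (u q)) (area u) ∧
    ∫ q, conformalKernel x s (u q) ∂area u ≤ B

lemma KernelLE.nonneg {x : E n} {B : ℝ} (h : KernelLE u x B) : 0 ≤ B :=
  (integral_nonneg fun _ => conformalKernel_nonneg _ _ _).trans (h 1 one_pos).2

lemma KernelLE.lintegral_le {x : E n} {B s : ℝ} (h : KernelLE u x B) (hs : 0 < s) :
    ∫⁻ q, ENNReal.ofReal (conformalKernel x s (u q)) ∂area u ≤ ENNReal.ofReal B := by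
  rw [← ofReal_integral_eq_lintegral_ofReal (h s hs).1
    (.of_forall fun q => conformalKernel_nonneg _ _ _)]
  exact ENNReal.ofReal_le_ofReal (h s hs).2

lemma DensityGE.le {c B : ℝ} (h : DensityGE u q c) (hB : KernelLE u (u q) B) : c ≤ B := by
  refine (ENNReal.ofReal_le_ofReal_iff hB.nonneg).1 ((h Set.univ univ_mem).trans ?_)
  simp only [Measure.restrict_univ]
  refine liminf_le_of_frequently_le' (Eventually.frequently ?_)
  exact eventually_nhdsWithin_of_forall fun s hs => hB.lintegral_le hs

lemma liminf_add_liminf_le_liminf_add {ι : Type*} {l : Filter ι} (f g : ι → ℝ≥0∞) :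
    liminf f l + liminf g l ≤ liminf (fun i => f i + g i) l := by
  rw [liminf_eq_iSup_iInf, liminf_eq_iSup_iInf]
  refine ENNReal.biSup_add_biSup_le' ⟨Set.univ, univ_mem⟩ ⟨Set.univ, univ_mem⟩
    fun s hs t ht => ?_
  refine le_liminf_of_le (h := ?_)
  filter_upwards [hs, ht] with i his hit using
    add_le_add (biInf_le f his) (biInf_le g hit)

lemma DensityGE.add_le [T2Space M] [OpensMeasurableSpace M] {q₁ q₂ : M} {c₁ c₂ B : ℝ}
    (h₁ : DensityGE u q₁ c₁) (h₂ : DensityGE u q₂ c₂) (hne : q₁ ≠ q₂) (hu : u q₁ = u q₂)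
    (hB : KernelLE u (u q₁) B) : c₁ + c₂ ≤ B := by
  obtain ⟨U₁, U₂, hU₁, hU₂, hq₁, hq₂, hdisj⟩ := t2_separation hne
  have h₂ := h₂ U₂ (hU₂.mem_nhds hq₂)
  rw [← hu] at h₂
  refine (ENNReal.ofReal_le_ofReal_iff hB.nonneg).1 (ENNReal.ofReal_add_le.trans
    ((add_le_add (h₁ U₁ (hU₁.mem_nhds hq₁)) h₂).trans
      ((liminf_add_liminf_le_liminf_add _ _).trans ?_)))
  refine liminf_le_of_frequently_le' (f := 𝓝[>] (0 : ℝ))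
    (eventually_nhdsWithin_of_forall fun s hs => ?_).frequently
  rw [← lintegral_union hU₂.measurableSet hdisj]
  exact (setLIntegral_le_lintegral _ _).trans (hB.lintegral_le hs)

section LowerBound

variable [BorelSpace M]

lemma setLIntegral_chartArea (u : M → E n) (p : M) {A : Set M} (hA : MeasurableSet A)
    {f : M → ℝ≥0∞} (hf : Measurable f)
    (hJ : ContinuousOn (chartDeriv u p) (extChartAt (𝓡∂ 2) p).target) :
    ∫⁻ q in A, f q ∂chartArea u p =
      ∫⁻ x in (extChartAt (𝓡∂ 2) p).symm ⁻¹' A ∩ (extChartAt (𝓡∂ 2) p).target,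
        ENNReal.ofReal (jacobian (chartDeriv u p x)) * f ((extChartAt (𝓡∂ 2) p).symm x) := by
  have hsymm : AEMeasurable (extChartAt (𝓡∂ 2) p).symm
      ((volume.restrict (extChartAt (𝓡∂ 2) p).target).withDensity fun x =>
        ENNReal.ofReal (jacobian (chartDeriv u p x))) :=
    ((continuousOn_extChartAt_symm p).aemeasurable (measurableSet_extChartAt_target p)).mono_ac
      (withDensity_absolutelyContinuous _ _)
  have hdens : AEMeasurable (fun x => ENNReal.ofReal (jacobian (chartDeriv u p x)))
      (volume.restrict (extChartAt (𝓡∂ 2) p).target) :=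
    ((continuous_jacobian.comp_continuousOn hJ).aemeasurable
      (measurableSet_extChartAt_target p)).ennreal_ofReal
  change ∫⁻ q in A, f q ∂(Measure.map _ (Measure.withDensity _
    fun x => ENNReal.ofReal (jacobian (chartDeriv u p x)))) = _
  rw [Measure.restrict_map_of_aemeasurable hsymm hA,
    lintegral_map' hf.aemeasurable hsymm.restrict, restrict_withDensity',
    lintegral_withDensity_eq_lintegral_mul₀' hdens.restrict
      (by rw [← restrict_withDensity']; exact hf.comp_aemeasurable hsymm.restrict),
    Measure.restrict_restrict' (measurableSet_extChartAt_target p)]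
  simp only [Pi.mul_apply]

variable [IsManifold (𝓡∂ 2) 1 M]

lemma IsLocalModel.densityGE (hu : ContMDiff (𝓡∂ 2) 𝓘(ℝ, E n) 1 u) (hm : m ≠ 0) {ζ : E 2 → ℂ}
    {P : ℂ →ₗᵢ[ℝ] E n} (h : IsLocalModel (u ∘ (extChartAt (𝓡∂ 2) q).symm) (Set.range (𝓡∂ 2))
      (extChartAt (𝓡∂ 2) q q) m ζ P) {C : Set (E 2)} (hC : MeasurableSet C)
    (hcone : ∀ y ∈ C, ∀ᶠ σ in 𝓝[>] (0 : ℝ),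
      extChartAt (𝓡∂ 2) q q + σ • y ∈ Set.range (𝓡∂ 2)) {c : ℝ}
    (hc : ENNReal.ofReal (fderivWithin ℝ ζ (Set.range (𝓡∂ 2)) (extChartAt (𝓡∂ 2) q q)).normDet *
      ∫⁻ y in C, ENNReal.ofReal (branchKernel m
        (fderivWithin ℝ ζ (Set.range (𝓡∂ 2)) (extChartAt (𝓡∂ 2) q q) y)) = ENNReal.ofReal c) :
    DensityGE u q c := by
  intro U hU
  obtain ⟨O, hOU, hO, hqO⟩ := mem_nhds_iff.1 hU
  have hsymm : Tendsto (extChartAt (𝓡∂ 2) q).symm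
      (𝓝[Set.range (𝓡∂ 2)] (extChartAt (𝓡∂ 2) q q)) (𝓝 q) :=
    (map_extChartAt_symm_nhdsWithin_range q).le
  refine hc.ge.trans ((h.mul_setLIntegral_branchKernel_le_liminf (𝓡∂ 2).uniqueDiffOn
    (extChartAt_self_mem_range q) hm (measurableSet_symm_preimage_inter_target q hO.measurableSet)
    (Set.inter_subset_right.trans (extChartAt_target_subset_range q))
    (inter_mem (hsymm (hO.mem_nhds hqO)) (extChartAt_target_mem_nhdsWithin q))
    (fun x hx => (hasFDerivWithinAt_chartDeriv hu hx.2).differentiableWithinAt)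
    ((continuousOn_chartDeriv hu q).mono Set.inter_subset_right) hC hcone).trans
      (liminf_le_liminf ?_))
  filter_upwards [self_mem_nhdsWithin] with s hs
  calc ∫⁻ x in (extChartAt (𝓡∂ 2) q).symm ⁻¹' O ∩ (extChartAt (𝓡∂ 2) q).target,
        ENNReal.ofReal ((chartDeriv u q x).normDet * conformalKernel
          ((u ∘ (extChartAt (𝓡∂ 2) q).symm) (extChartAt (𝓡∂ 2) q q)) s
          ((u ∘ (extChartAt (𝓡∂ 2) q).symm) x))
      = ∫⁻ q' in O, ENNReal.ofReal (conformalKernel (u q) s (u q')) ∂chartArea u q := by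
        rw [setLIntegral_chartArea u q hO.measurableSet
          (f := fun q' => ENNReal.ofReal (conformalKernel (u q) s (u q')))
          ((continuous_conformalKernel (u q) (ne_of_gt hs)).comp
            hu.continuous).measurable.ennreal_ofReal (continuousOn_chartDeriv hu q)]
        simp only [Function.comp_apply, extChartAt_to_inv, jacobian_eq_normDet,
          ENNReal.ofReal_mul (LinearMap.normDet_nonneg _)]
    _ ≤ ∫⁻ q' in U, ENNReal.ofReal (conformalKernel (u q) s (u q')) ∂area u :=
        lintegral_mono' (Measure.restrict_mono hOU (le_iSup (chartArea u) q)) le_rfl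

lemma HasOrder.densityGE_of_interior (hu : ContMDiff (𝓡∂ 2) 𝓘(ℝ, E n) 1 u) (hm : m ≠ 0)
    (h : HasOrder u q m) (hq : (𝓡∂ 2).IsInteriorPoint q) :
    DensityGE u q (2 * Real.pi * m) := by
  obtain ⟨ζ, P, h⟩ := h
  refine h.densityGE hu hm MeasurableSet.univ (fun y _ => ?_) ?_
  · have hlim : Tendsto (fun σ : ℝ => extChartAt (𝓡∂ 2) q q + σ • y) (𝓝[>] 0)
        (𝓝 (extChartAt (𝓡∂ 2) q q)) := by
      have : Continuous fun σ : ℝ => extChartAt (𝓡∂ 2) q q + σ • y := by fun_prop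
      simpa using (this.tendsto 0).mono_left nhdsWithin_le_nhds
    exact hlim (mem_interior_iff_mem_nhds.1 hq)
  · rw [Measure.restrict_univ]
    exact ofReal_normDet_mul_lintegral_branchKernel h.injective hm

lemma HasOrder.densityGE_of_boundary (hu : ContMDiff (𝓡∂ 2) 𝓘(ℝ, E n) 1 u) (hm : m ≠ 0)
    (h : HasOrder u q m) (hq : q ∈ (𝓡∂ 2).boundary M) : DensityGE u q (Real.pi * m) := by
  obtain ⟨ζ, P, h⟩ := h
  refine h.densityGE hu hm (C := {y | 0 < y 0})
    (measurableSet_lt measurable_const (by fun_prop)) (fun y hy => ?_)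
    (ofReal_normDet_mul_setLIntegral_pos_branchKernel h.injective hm)
  filter_upwards [self_mem_nhdsWithin] with σ hσ
  rw [range_modelWithCornersEuclideanHalfSpace]
  have : 0 < σ * y 0 := mul_pos hσ hy
  rw [Set.mem_ofPred, PiLp.add_apply, extChartAt_self_apply_zero_of_boundary hq, zero_add]
  exact this.le

lemma IsBranchedImmersion.densityGE_of_interior (hu : IsBranchedImmersion u)
    (hq : (𝓡∂ 2).IsInteriorPoint q) : DensityGE u q (2 * Real.pi) := by
  obtain ⟨m, hm, h⟩ := hu.exists_hasOrder q
  refine (h.densityGE_of_interior hu.contMDiff hm hq).mono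
    (le_mul_of_one_le_right Real.two_pi_pos.le ?_)
  exact_mod_cast Nat.one_le_iff_ne_zero.2 hm

lemma IsBranchedImmersion.densityGE_of_boundary (hu : IsBranchedImmersion u)
    (hq : q ∈ (𝓡∂ 2).boundary M) : DensityGE u q Real.pi := by
  obtain ⟨m, hm, h⟩ := hu.exists_hasOrder q
  refine (h.densityGE_of_boundary hu.contMDiff hm hq).mono
    (le_mul_of_one_le_right Real.pi_pos.le ?_)
  exact_mod_cast Nat.one_le_iff_ne_zero.2 hm

end LowerBound

end Density

/-! ### Boundary points -/

lemma not_eventually_nhdsNE_lt_of_injOn {g : ℝ → ℝ} {S : Set ℝ} {a : ℝ} (hS : S ∈ 𝓝 a)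
    (hcont : ContinuousOn g S) (hinj : Set.InjOn g S) : ¬ ∀ᶠ s in 𝓝[≠] a, g a < g s := by
  intro hmin
  obtain ⟨ε, hε, hball⟩ := Metric.eventually_nhds_iff.1
    ((eventually_nhdsWithin_iff.1 hmin).and hS)
  have h (s : ℝ) (hs : s ∈ Set.Icc (a - ε / 2) (a + ε / 2)) : (s ≠ a → g a < g s) ∧ s ∈ S :=
    hball (by rw [Real.dist_eq, abs_lt]; constructor <;> linarith [hs.1, hs.2])
  have hsub : Set.Icc (a - ε / 2) (a + ε / 2) ⊆ S := fun s hs => (h s hs).2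
  have hleft : a - ε / 2 ∈ Set.Icc (a - ε / 2) (a + ε / 2) := ⟨le_rfl, by linarith⟩
  have hmid : a ∈ Set.Icc (a - ε / 2) (a + ε / 2) := ⟨by linarith, by linarith⟩
  have hright : a + ε / 2 ∈ Set.Icc (a - ε / 2) (a + ε / 2) := ⟨by linarith, le_rfl⟩
  rcases (hcont.mono hsub).strictMonoOn_of_injOn_Icc' (by linarith) (hinj.mono hsub) with hg | hg
  · exact lt_asymm ((h _ hleft).1 (by linarith)) (hg hleft hmid (by linarith))
  · exact lt_asymm ((h _ hright).1 (by linarith)) (hg hmid hright (by linarith))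

/-- A simple closed `C¹` curve does not turn back: the height along the tangent would have a strict
local minimum, but it is injective on the curve. -/
lemma IsC1ClosedCurve.not_tendsto_inv_pow_smul_sub {n : ℕ} {γ : ℝ → E n}
    (hγ : IsC1ClosedCurve γ) (t₀ : ℝ) {σ : ℝ → E n} {S : Set ℝ} (hS : S ∈ 𝓝 0)
    (hmaps : Set.MapsTo σ S (Set.range γ)) (hcont : ContinuousOn σ S) (hinj : Set.InjOn σ S)
    (h0 : σ 0 = γ t₀) {k : ℕ} (hk : k ≠ 0) (heven : Even k) {w : E n} (hw : w ≠ 0) :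
    ¬ Tendsto (fun s => (s ^ k)⁻¹ • (σ s - γ t₀)) (𝓝[≠] 0) (𝓝 w) := by
  intro hlim
  have hproj := hγ.starProjection_eq_zero_of_tendsto t₀ hk
    (nhdsWithin_le_nhds (eventually_of_mem hS hmaps)) hlim
  rw [Submodule.starProjection_apply_eq_zero_iff, Submodule.orthogonal_orthogonal] at hproj
  obtain ⟨c, rfl⟩ := Submodule.mem_span_singleton.1 hproj
  obtain ⟨U, hU, hUinj⟩ := hγ.exists_injOn_inner_deriv t₀
  have hσU : σ ⁻¹' U ∈ 𝓝 0 := by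
    have hσ : Tendsto σ (𝓝 0) (𝓝[Set.range γ] (σ 0)) :=
      tendsto_nhdsWithin_iff.2 ⟨hcont.continuousAt hS, eventually_of_mem hS hmaps⟩
    exact hσ (h0 ▸ hU)
  refine not_eventually_nhdsNE_lt_of_injOn
    (g := fun s => inner ℝ (σ s - γ t₀) (c • deriv γ t₀)) (inter_mem hS hσU) ?_ ?_ ?_
  · exact ((hcont.sub continuousOn_const).inner (𝕜 := ℝ) continuousOn_const).mono
      Set.inter_subset_left
  · intro s hs s' hs' hss
    simp only [inner_smul_right] at hss
    exact hinj hs.1 hs'.1 (hUinj hs.2 hs'.2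
      (mul_left_cancel₀ (left_ne_zero_of_smul hw) hss))
  · have height_lim := hlim.inner (𝕜 := ℝ) (tendsto_const_nhds (x := c • deriv γ t₀))
    filter_upwards [height_lim.eventually (lt_mem_nhds (real_inner_self_pos.2 hw)),
      self_mem_nhdsWithin] with s hs hs0
    rw [real_inner_smul_left] at hs
    rw [h0, sub_self, inner_zero_left]
    exact pos_of_mul_pos_right hs (inv_pos.2 (heven.pow_pos hs0)).le

section Boundary

variable {n : ℕ} {M : Type*} [TopologicalSpace M] [ChartedSpace (EuclideanHalfSpace 2) M] {q : M}

/-- The line through the image of `q` in the chart at `q`, parallel to the boundary of the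
half-plane. -/
def boundaryLine (q : M) (s : ℝ) : E 2 :=
  extChartAt (𝓡∂ 2) q q + s • EuclideanSpace.single 1 1

/-- The image of the boundary line under the inverse of the chart at `q`: for a boundary point `q`
this is the boundary of `M` near `q`, parametrized by an interval around `0`. -/
def boundaryPath (q : M) (s : ℝ) : M :=
  (extChartAt (𝓡∂ 2) q).symm (boundaryLine q s)

lemma boundaryPath_zero (q : M) : boundaryPath q 0 = q := by
  rw [boundaryPath, boundaryLine, zero_smul, add_zero, extChartAt_to_inv]

lemma continuous_boundaryLine (q : M) : Continuous (boundaryLine q) := by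
  unfold boundaryLine
  fun_prop

lemma boundaryLine_injective (q : M) : Function.Injective (boundaryLine q) := by
  have he : EuclideanSpace.single (1 : Fin 2) (1 : ℝ) ≠ 0 := by simp
  exact (add_right_injective _).comp (smul_left_injective ℝ he)

lemma boundaryLine_apply_zero (hq : q ∈ (𝓡∂ 2).boundary M) (s : ℝ) : boundaryLine q s 0 = 0 := by
  simp only [boundaryLine, PiLp.add_apply, PiLp.smul_apply,
    extChartAt_self_apply_zero_of_boundary hq]
  simp

lemma boundaryLine_mem_range (hq : q ∈ (𝓡∂ 2).boundary M) (s : ℝ) :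
    boundaryLine q s ∈ Set.range (𝓡∂ 2) := by
  rw [range_modelWithCornersEuclideanHalfSpace]
  exact (boundaryLine_apply_zero hq s).ge

lemma eventually_boundaryLine_mem_target (hq : q ∈ (𝓡∂ 2).boundary M) :
    ∀ᶠ s in 𝓝 0, boundaryLine q s ∈ (extChartAt (𝓡∂ 2) q).target := by
  have hlim : Tendsto (boundaryLine q) (𝓝 0)
      (𝓝[Set.range (𝓡∂ 2)] (extChartAt (𝓡∂ 2) q q)) := by
    refine tendsto_nhdsWithin_iff.2 ⟨?_, Eventually.of_forall (boundaryLine_mem_range hq)⟩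
    simpa [boundaryLine] using (continuous_boundaryLine q).tendsto 0
  exact hlim (extChartAt_target_mem_nhdsWithin q)

lemma norm_boundaryConormal_le (u : M → E n) (x : E n) : ‖boundaryConormal u x‖ ≤ 1 := by
  unfold boundaryConormal
  split_ifs
  · simp only [conormal, norm_smul, norm_inv, norm_norm]
    exact inv_mul_le_one
  · simp

lemma inner_conormal_du_single (u : M → E n) (q : M) :
    inner ℝ (conormal u q) (du u q (EuclideanSpace.single 1 1)) = 0 := by
  refine (Submodule.mem_orthogonal' _ _).1 (Submodule.smul_mem _ _ ?_) _
    (Submodule.mem_span_singleton_self _)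
  exact Submodule.starProjection_apply_mem _ _

variable [IsManifold (𝓡∂ 2) 1 M]

lemma boundaryPath_mem_boundary (hq : q ∈ (𝓡∂ 2).boundary M) {s : ℝ}
    (hs : boundaryLine q s ∈ (extChartAt (𝓡∂ 2) q).target) :
    boundaryPath q s ∈ (𝓡∂ 2).boundary M := by
  have hsrc := (extChartAt (𝓡∂ 2) q).map_target hs
  rw [extChartAt_source] at hsrc
  by_contra hb
  have hint := (ModelWithCorners.isInteriorPoint_iff_of_mem_atlas (I := 𝓡∂ 2) one_ne_zero
    (chart_mem_atlas (EuclideanHalfSpace 2) q) hsrc).1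
      ((ModelWithCorners.isInteriorPoint_iff_not_isBoundaryPoint _).2 hb)
  change extChartAt (𝓡∂ 2) q _ ∈ interior (extChartAt (𝓡∂ 2) q).target at hint
  rw [(extChartAt (𝓡∂ 2) q).right_inv hs] at hint
  have hpos := interior_mono (extChartAt_target_subset_range (I := 𝓡∂ 2) q) hint
  rw [interior_range_modelWithCornersEuclideanHalfSpace] at hpos
  exact (ne_of_gt hpos) (boundaryLine_apply_zero hq s)

variable {u : M → E n} {γ : ℝ → E n}

lemma eventually_comp_boundaryPath_mem_boundaryCurve (hq : q ∈ (𝓡∂ 2).boundary M) :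
    ∀ᶠ s in 𝓝 0, u (boundaryPath q s) ∈ boundaryCurve u := by
  filter_upwards [eventually_boundaryLine_mem_target hq] with s hs
  exact Set.mem_image_of_mem u (boundaryPath_mem_boundary hq hs)

lemma hasDerivAt_comp_boundaryPath (hu : ContMDiff (𝓡∂ 2) 𝓘(ℝ, E n) 1 u)
    (hq : q ∈ (𝓡∂ 2).boundary M) :
    HasDerivAt (fun s => u (boundaryPath q s)) (du u q (EuclideanSpace.single 1 1)) 0 := by
  have hline : HasDerivAt (boundaryLine q) (EuclideanSpace.single 1 1) 0 := by
    have h := ((hasDerivAt_id (0 : ℝ)).smul_const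
      (EuclideanSpace.single (1 : Fin 2) (1 : ℝ))).const_add (extChartAt (𝓡∂ 2) q q)
    rwa [one_smul] at h
  have hchart := hasFDerivWithinAt_chartDeriv hu (mem_extChartAt_target (I := 𝓡∂ 2) q)
  rw [← du_eq_chartDeriv hu, show extChartAt (𝓡∂ 2) q q = boundaryLine q 0 by
    simp only [boundaryLine, zero_smul, add_zero]] at hchart
  exact hchart.comp_hasDerivAt 0 hline (Eventually.of_forall (boundaryLine_mem_range hq))

lemma du_single_mem_span_deriv (hu : ContMDiff (𝓡∂ 2) 𝓘(ℝ, E n) 1 u) (hγ : IsC1ClosedCurve γ)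
    (hΓ : boundaryCurve u = Set.range γ) (hq : q ∈ (𝓡∂ 2).boundary M) {t : ℝ} (ht : u q = γ t) :
    du u q (EuclideanSpace.single 1 1) ∈ ℝ ∙ deriv γ t := by
  rw [← Submodule.orthogonal_orthogonal (ℝ ∙ deriv γ t),
    ← Submodule.starProjection_apply_eq_zero_iff]
  refine hγ.starProjection_eq_zero_of_tendsto t one_ne_zero
    (nhdsWithin_le_nhds (hΓ ▸ eventually_comp_boundaryPath_mem_boundaryCurve hq)) ?_
  refine (hasDerivAt_iff_tendsto_slope.1 (hasDerivAt_comp_boundaryPath hu hq)).congr fun s => ?_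
  rw [slope_def_module, sub_zero, pow_one, boundaryPath_zero, ht]

lemma inner_conormal_deriv (hu : IsBranchedImmersion u) (hγ : IsC1ClosedCurve γ)
    (hΓ : boundaryCurve u = Set.range γ) (hq : q ∈ (𝓡∂ 2).boundary M) {t : ℝ} (ht : u q = γ t) :
    inner ℝ (conormal u q) (deriv γ t) = 0 := by
  rcases hu.immersed_or_branch q with hinj | hbranch
  · have hne : du u q (EuclideanSpace.single 1 1) ≠ 0 := by
      rw [← map_zero (du u q)]
      exact hinj.ne (by simp)
    obtain ⟨c, hc⟩ := Submodule.mem_span_singleton.1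
      (du_single_mem_span_deriv hu.contMDiff hγ hΓ hq ht)
    have h := inner_conormal_du_single u q
    rw [← hc, inner_smul_right] at h
    exact (mul_eq_zero.1 h).resolve_left (left_ne_zero_of_smul (hc ▸ hne))
  · obtain ⟨m, hm, h⟩ := hbranch.exists_hasOrder
    simp [conormal, h.du_eq_zero hu.contMDiff hm]

lemma inner_boundaryConormal_deriv (hu : IsBranchedImmersion u) (hγ : IsC1ClosedCurve γ)
    (hΓ : boundaryCurve u = Set.range γ) (t : ℝ) :
    inner ℝ (boundaryConormal u (γ t)) (deriv γ t) = 0 := by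
  unfold boundaryConormal
  split_ifs with h
  · exact inner_conormal_deriv hu hγ hΓ h.choose_spec.1 h.choose_spec.2
  · exact inner_zero_left _

lemma exists_nhds_boundaryPath (hq : q ∈ (𝓡∂ 2).boundary M) :
    ∃ S ∈ 𝓝 (0 : ℝ), Set.MapsTo (boundaryPath q) S ((𝓡∂ 2).boundary M) ∧
      ContinuousOn (boundaryPath q) S ∧ Set.InjOn (boundaryPath q) S := by
  refine ⟨boundaryLine q ⁻¹' (extChartAt (𝓡∂ 2) q).target,
    eventually_boundaryLine_mem_target hq, fun s hs => boundaryPath_mem_boundary hq hs,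
    (continuousOn_extChartAt_symm q).comp (continuous_boundaryLine q).continuousOn
      (Set.mapsTo_preimage _ _), ?_⟩
  exact (extChartAt (𝓡∂ 2) q).symm.injOn.comp (boundaryLine_injective q).injOn
    (Set.mapsTo_preimage _ _)

lemma HasOrder.odd_of_boundary {m : ℕ} (h : HasOrder u q m) (hm : m ≠ 0)
    (hu : Continuous u) (hinj : Set.InjOn u ((𝓡∂ 2).boundary M)) (hγ : IsC1ClosedCurve γ)
    (hΓ : boundaryCurve u = Set.range γ) (hq : q ∈ (𝓡∂ 2).boundary M) : Odd m := by
  by_contra heven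
  rw [Nat.not_odd_iff_even] at heven
  obtain ⟨ζ, P, h⟩ := h
  obtain ⟨t, ht⟩ : u q ∈ Set.range γ := hΓ ▸ Set.mem_image_of_mem u hq
  obtain ⟨S, hS, hmaps, hcont, hS_inj⟩ := exists_nhds_boundaryPath hq
  have hleading : P (fderivWithin ℝ ζ (Set.range (𝓡∂ 2)) (extChartAt (𝓡∂ 2) q q)
      (EuclideanSpace.single 1 1) ^ m) ≠ 0 := by
    rw [← map_zero P]
    refine P.injective.ne (pow_ne_zero m ?_)
    rw [← map_zero (fderivWithin ℝ ζ (Set.range (𝓡∂ 2)) (extChartAt (𝓡∂ 2) q q))]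
    exact h.injective.ne (by simp)
  refine hγ.not_tendsto_inv_pow_smul_sub t (σ := fun s => u (boundaryPath q s)) hS
    (fun s hs => hΓ ▸ Set.mem_image_of_mem u (hmaps hs)) (hu.comp_continuousOn hcont)
    (hinj.comp hS_inj hmaps) (by rw [boundaryPath_zero, ht]) hm heven hleading ?_
  have hlim := h.tendsto_inv_pow_smul_sub le_rfl
    (Eventually.of_forall fun s => boundaryLine_mem_range hq s)
  simpa only [Function.comp_apply, extChartAt_to_inv, ht, boundaryPath, boundaryLine] using hlim

end Boundary

/-! ### Smallness of the mean curvature -/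

section MeanCurvature

variable {p : ℝ≥0∞}

lemma two_lt_toReal (hp : 2 < p) (hp_top : p ≠ ⊤) : 2 < p.toReal := by
  simpa only [ENNReal.toReal_ofNat] using
    (ENNReal.toReal_lt_toReal ENNReal.ofNat_ne_top hp_top).2 hp

lemma one_le_constC (hp : 2 < p) : 1 ≤ constC p := by
  unfold constC
  split_ifs with hp_top
  · exact le_rfl
  have hp2 := two_lt_toReal hp hp_top
  have hfactor : 2 ≤ 2 * p.toReal / (p.toReal - 2) := by
    rw [le_div_iff₀ (by linarith)]
    linarith
  have hpow : 2 / Real.pi ≤ (2 / Real.pi) ^ (1 / p.toReal) :=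
    Real.self_le_rpow_of_le_one (by positivity) ((div_le_one Real.pi_pos).2 Real.two_le_pi)
      ((div_le_one (by linarith)).2 (by linarith))
  calc (1 : ℝ) ≤ 2 * (2 / Real.pi) := by
        rw [← mul_div_assoc, le_div_iff₀ Real.pi_pos]
        linarith [Real.pi_le_four]
    _ ≤ _ := mul_le_mul hfactor hpow (by positivity) (by linarith)

lemma expAlpha_mem_Icc (hp : 2 < p) : expAlpha p ∈ Set.Icc (0 : ℝ) 1 := by
  unfold expAlpha
  split_ifs with hp_top
  · simp
  have hp2 := two_lt_toReal hp hp_top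
  have hle : 2 / p.toReal ≤ 1 := (div_le_one (by linarith)).2 hp2.le
  have hnonneg : 0 ≤ 2 / p.toReal := by positivity
  constructor <;> linarith

lemma one_half_sub_one_div_toReal (p : ℝ≥0∞) :
    1 / (2 : ℝ≥0∞).toReal - 1 / p.toReal = expAlpha p / 2 := by
  unfold expAlpha
  split_ifs with hp_top
  · simp [hp_top]
  · rw [ENNReal.toReal_ofNat]
    ring

lemma integral_norm_sq_le {α F : Type*} [MeasurableSpace α] [NormedAddCommGroup F]
    {μ : Measure α} [IsFiniteMeasure μ] {H : α → F} (hp : 2 < p) (hH : MemLp H p μ) :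
    ∫ q, ‖H q‖ ^ 2 ∂μ ≤ (eLpNorm H p μ).toReal ^ 2 * μ.real Set.univ ^ expAlpha p := by
  have norm_le : (eLpNorm H 2 μ).toReal ≤
      (eLpNorm H p μ).toReal * μ.real Set.univ ^ (expAlpha p / 2) := by
    have hle := eLpNorm_le_eLpNorm_mul_rpow_measure_univ hp.le hH.aestronglyMeasurable
    rw [one_half_sub_one_div_toReal] at hle
    have hexp : 0 ≤ expAlpha p / 2 := by linarith [(expAlpha_mem_Icc hp).1]
    refine (ENNReal.toReal_mono (ENNReal.mul_ne_top hH.eLpNorm_ne_top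
      (ENNReal.rpow_ne_top_of_nonneg hexp (measure_ne_top _ _))) hle).trans_eq ?_
    rw [ENNReal.toReal_mul, ← ENNReal.toReal_rpow, measureReal_def]
  have sq_norm : (eLpNorm H 2 μ).toReal ^ 2 = ∫ q, ‖H q‖ ^ 2 ∂μ := by
    have hnonneg : 0 ≤ ∫ q, ‖H q‖ ^ 2 ∂μ := integral_nonneg fun _ => sq_nonneg _
    rw [(hH.mono_exponent hp.le).eLpNorm_eq_integral_rpow_norm two_ne_zero ENNReal.ofNat_ne_top]
    simp only [ENNReal.toReal_ofNat, Real.rpow_two]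
    rw [ENNReal.toReal_ofReal (by positivity), ← Real.rpow_mul_natCast hnonneg]
    norm_num
  calc ∫ q, ‖H q‖ ^ 2 ∂μ ≤
        ((eLpNorm H p μ).toReal * μ.real Set.univ ^ (expAlpha p / 2)) ^ 2 :=
        sq_norm ▸ pow_le_pow_left₀ ENNReal.toReal_nonneg norm_le 2
    _ = (eLpNorm H p μ).toReal ^ 2 * μ.real Set.univ ^ expAlpha p := by
        rw [mul_pow, ← Real.rpow_mul_natCast measureReal_nonneg, Nat.cast_ofNat,
          div_mul_cancel₀ _ two_ne_zero]

lemma rpow_le_one_add {a α : ℝ} (ha : 0 ≤ a) (hα : α ∈ Set.Icc (0 : ℝ) 1) : a ^ α ≤ 1 + a := by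
  rcases le_total a 1 with h | h
  · linarith [Real.rpow_le_one ha h hα.1]
  · linarith [Real.rpow_le_self_of_one_le h hα.2]

lemma rpow_expAlpha_scale_le {N A r : ℝ} (hp : 2 < p) (hA : 0 ≤ A) (hr : 0 < r) :
    N ^ 2 * A ^ expAlpha p ≤ (N * r ^ expAlpha p) ^ 2 * (1 + A / r ^ 2) := by
  have hscale : A = r ^ 2 * (A / r ^ 2) := by field_simp
  calc N ^ 2 * A ^ expAlpha p
      = (N * r ^ expAlpha p) ^ 2 * (A / r ^ 2) ^ expAlpha p := by
        conv_lhs => rw [hscale, Real.mul_rpow (by positivity) (by positivity),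
          ← Real.rpow_pow_comm hr.le]
        ring
    _ ≤ _ := by
        gcongr
        exact rpow_le_one_add (by positivity) (expAlpha_mem_Icc hp)

end MeanCurvature

/-! ### Embeddedness -/

section Embeddedness

lemma diam_range_pos {n : ℕ} {X : Type*} [TopologicalSpace X] [CompactSpace X] {u : X → E n}
    (hu : Continuous u) {γ : ℝ → E n} (hγ : IsC1ClosedCurve γ)
    (hsub : Set.range γ ⊆ Set.range u) : 0 < Metric.diam (Set.range u) := by
  have hne : γ 0 ≠ γ (1 / 2) := hγ.simple.ne (by norm_num) (by norm_num) (by norm_num)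
  exact (dist_pos.2 hne).trans_le (Metric.dist_le_diam_of_mem (isCompact_range hu).isBounded
    (hsub ⟨_, rfl⟩) (hsub ⟨_, rfl⟩))

variable {n : ℕ} {M : Type*} [TopologicalSpace M] [ChartedSpace (EuclideanHalfSpace 2) M]
  [IsManifold (𝓡∂ 2) 1 M] [MeasurableSpace M] [BorelSpace M] {u : M → E n} {γ : ℝ → E n} {B : ℝ}

lemma injective_of_kernelLE [T2Space M] (hu : IsBranchedImmersion u)
    (hinj : Set.InjOn u ((𝓡∂ 2).boundary M)) (hB : ∀ x, KernelLE u x B) (hB_lt : B < 4 * Real.pi)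
    (hB_boundary : ∀ q ∈ (𝓡∂ 2).boundary M, KernelLE u (u q) (B - Real.pi)) :
    Function.Injective u := by
  have boundary_ne_interior {q₁ q₂ : M} (h₁ : q₁ ∈ (𝓡∂ 2).boundary M)
      (h₂ : (𝓡∂ 2).IsInteriorPoint q₂) : u q₁ ≠ u q₂ := by
    intro h
    have hne : q₁ ≠ q₂ := fun hq =>
      (ModelWithCorners.isInteriorPoint_iff_not_isBoundaryPoint _).1 h₂ (hq ▸ h₁)
    have := (hu.densityGE_of_boundary h₁).add_le (hu.densityGE_of_interior h₂) hne h
      (hB_boundary q₁ h₁)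
    linarith
  intro q₁ q₂ h
  by_contra hne
  rcases (𝓡∂ 2).isInteriorPoint_or_isBoundaryPoint q₁ with h₁ | h₁ <;>
    rcases (𝓡∂ 2).isInteriorPoint_or_isBoundaryPoint q₂ with h₂ | h₂
  · have := (hu.densityGE_of_interior h₁).add_le (hu.densityGE_of_interior h₂) hne h (hB (u q₁))
    linarith
  · exact boundary_ne_interior h₂ h₁ h.symm
  · exact boundary_ne_interior h₁ h₂ h
  · exact hne (hinj h₁ h₂ h)

lemma injective_du_of_kernelLE (hu : IsBranchedImmersion u)
    (hinj : Set.InjOn u ((𝓡∂ 2).boundary M)) (hγ : IsC1ClosedCurve γ)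
    (hΓ : boundaryCurve u = Set.range γ) (hB : ∀ x, KernelLE u x B) (hB_lt : B < 4 * Real.pi)
    (hB_boundary : ∀ q ∈ (𝓡∂ 2).boundary M, KernelLE u (u q) (B - Real.pi)) (q : M) :
    Function.Injective (du u q) := by
  refine (hu.immersed_or_branch q).resolve_right fun hbranch => ?_
  obtain ⟨m, hm, h⟩ := hbranch.exists_hasOrder
  have hm₀ : m ≠ 0 := by lia
  rcases (𝓡∂ 2).isInteriorPoint_or_isBoundaryPoint q with hq | hq
  · have hm_lt : 2 * Real.pi * m < 2 * Real.pi * 2 := by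
      linarith [(h.densityGE_of_interior hu.contMDiff hm₀ hq).le (hB (u q))]
    have : m < 2 := by exact_mod_cast lt_of_mul_lt_mul_left hm_lt Real.two_pi_pos.le
    lia
  · have hm_lt : Real.pi * m < Real.pi * 3 := by
      linarith [(h.densityGE_of_boundary hu.contMDiff hm₀ hq).le (hB_boundary q hq)]
    have : m < 3 := by exact_mod_cast lt_of_mul_lt_mul_left hm_lt Real.pi_pos.le
    obtain ⟨k, rfl⟩ := h.odd_of_boundary hm₀ hu.contMDiff.continuous hinj hγ hΓ hq
    lia

variable [CompactSpace M] {H : M → E n}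

lemma integral_conformalKernel_le_integral_angularSpeed (hu : IsBranchedImmersion u)
    (hγ : IsC1ClosedCurve γ) (hΓ : boundaryCurve u = Set.range γ)
    (hnormal : ∀ᵐ q ∂area u, H q ∈ (tangentPlane u q)ᗮ) (hdiv : DivergenceIdentity u H)
    (hH : MemLp H 2 (area u)) (x₀ : E n) {s : ℝ} (hs : s ≠ 0) :
    ∫ q, conformalKernel x₀ s (u q) ∂area u ≤
      (∫ t in (0 : ℝ)..1, angularSpeed γ x₀ s t) + 1 / 8 * ∫ q, ‖H q‖ ^ 2 ∂area u := by
  refine (integral_conformalKernel_le hu.contMDiff hnormal hdiv hH x₀ hs).trans ?_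
  rw [hΓ]
  gcongr
  exact setIntegral_inner_radialField_le_integral_angularSpeed hγ.contDiff hγ.periodic
    (norm_boundaryConormal_le u) (inner_boundaryConormal_deriv hu hγ hΓ) x₀ hs

lemma kernelLE_totalCurvature_add (hu : IsBranchedImmersion u)
    (hγ : IsC1ClosedCurve γ) (hfin : totalCurvature γ ≠ ⊤) (hΓ : boundaryCurve u = Set.range γ)
    (hnormal : ∀ᵐ q ∂area u, H q ∈ (tangentPlane u q)ᗮ) (hdiv : DivergenceIdentity u H)
    (hH : MemLp H 2 (area u)) (x₀ : E n) :
    KernelLE u x₀ ((totalCurvature γ).toReal + 1 / 8 * ∫ q, ‖H q‖ ^ 2 ∂area u) := by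
  refine fun s hs => ⟨integrable_conformalKernel hu.contMDiff x₀ hs.ne', ?_⟩
  refine (integral_conformalKernel_le_integral_angularSpeed hu hγ hΓ hnormal hdiv hH x₀
    hs.ne').trans ?_
  gcongr
  exact integral_angularSpeed_le_totalCurvature hγ hfin x₀ hs.ne'

lemma kernelLE_totalCurvature_add_sub_pi (hu : IsBranchedImmersion u)
    (hγ : IsC1ClosedCurve γ) (hfin : totalCurvature γ ≠ ⊤) (hΓ : boundaryCurve u = Set.range γ)
    (hnormal : ∀ᵐ q ∂area u, H q ∈ (tangentPlane u q)ᗮ) (hdiv : DivergenceIdentity u H)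
    (hH : MemLp H 2 (area u)) {x₀ : E n} (hx₀ : x₀ ∈ boundaryCurve u) :
    KernelLE u x₀ ((totalCurvature γ).toReal + 1 / 8 * ∫ q, ‖H q‖ ^ 2 ∂area u - Real.pi) := by
  refine fun s hs => ⟨integrable_conformalKernel hu.contMDiff x₀ hs.ne', ?_⟩
  linarith [integral_angularSpeed_add_pi_le_totalCurvature hγ hfin (hΓ ▸ hx₀) hs.ne',
    integral_conformalKernel_le_integral_angularSpeed hu hγ hΓ hnormal hdiv hH x₀ hs.ne']

theorem isEmbedded_of_totalCurvature_add_lt_four_pi [T2Space M] (hu : IsBranchedImmersion u)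
    (hinj : Set.InjOn u ((𝓡∂ 2).boundary M)) (hγ : IsC1ClosedCurve γ)
    (hfin : totalCurvature γ ≠ ⊤) (hΓ : boundaryCurve u = Set.range γ)
    (hnormal : ∀ᵐ q ∂area u, H q ∈ (tangentPlane u q)ᗮ) (hdiv : DivergenceIdentity u H)
    (hH : MemLp H 2 (area u))
    (hlt : (totalCurvature γ).toReal + 1 / 8 * ∫ q, ‖H q‖ ^ 2 ∂area u < 4 * Real.pi) :
    IsEmbedded u := by
  have hB := kernelLE_totalCurvature_add hu hγ hfin hΓ hnormal hdiv hH
  have hB_boundary (q : M) (hq : q ∈ (𝓡∂ 2).boundary M) :=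
    kernelLE_totalCurvature_add_sub_pi hu hγ hfin hΓ hnormal hdiv hH
      (Set.mem_image_of_mem u hq)
  have hinjective := injective_of_kernelLE hu hinj hB hlt hB_boundary
  exact ⟨(hu.contMDiff.continuous.isClosedEmbedding hinjective).isEmbedding,
    injective_du_of_kernelLE hu hinj hγ hΓ hB hlt hB_boundary⟩

lemma measureReal_area_div_le (hu : ContMDiff (𝓡∂ 2) 𝓘(ℝ, E n) 1 u)
    (hd : 0 < Metric.diam (Set.range u)) {q₀ : M} (hB : KernelLE u (u q₀) B) :
    (area u).real Set.univ / (2 * Metric.diam (Set.range u) ^ 2) ≤ B := by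
  have := isFiniteMeasure_area hu
  set d := Metric.diam (Set.range u)
  have kernel_ge (q : M) : 1 / (2 * d ^ 2) ≤ conformalKernel (u q₀) d (u q) := by
    have hdist : ‖u q - u q₀‖ ≤ d := by
      rw [← dist_eq_norm]
      exact Metric.dist_le_diam_of_mem (isCompact_range hu.continuous).isBounded ⟨_, rfl⟩ ⟨_, rfl⟩
    calc 1 / (2 * d ^ 2) = 2 * d ^ 2 / (d ^ 2 + d ^ 2) ^ 2 := by field_simp; norm_num
      _ ≤ 2 * d ^ 2 / (d ^ 2 + ‖u q - u q₀‖ ^ 2) ^ 2 := by gcongr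
  calc (area u).real Set.univ / (2 * d ^ 2) = ∫ _q : M, 1 / (2 * d ^ 2) ∂area u := by
        rw [integral_const, smul_eq_mul, mul_one_div]
    _ ≤ ∫ q, conformalKernel (u q₀) d (u q) ∂area u :=
        integral_mono (integrable_const _) (hB d hd).1 kernel_ge
    _ ≤ B := (hB d hd).2

lemma integral_norm_sq_le_of_small {p : ℝ≥0∞} (hp : 2 < p)
    (hu : ContMDiff (𝓡∂ 2) 𝓘(ℝ, E n) 1 u) (hH : MemLp H p (area u))
    (hd : 0 < Metric.diam (Set.range u)) {δ : ℝ}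
    (hsmall : constC p * (eLpNorm H p (area u)).toReal * Metric.diam (Set.range u) ^ expAlpha p
      ≤ δ) :
    ∫ q, ‖H q‖ ^ 2 ∂area u ≤
      δ ^ 2 * (1 + (area u).real Set.univ / Metric.diam (Set.range u) ^ 2) := by
  have := isFiniteMeasure_area hu
  have norm_le : (eLpNorm H p (area u)).toReal * Metric.diam (Set.range u) ^ expAlpha p ≤ δ := by
    rw [mul_assoc] at hsmall
    exact (le_mul_of_one_le_left (by positivity) (one_le_constC hp)).trans hsmall
  refine (integral_norm_sq_le hp hH).trans
    ((rpow_expAlpha_scale_le hp measureReal_nonneg hd).trans ?_)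
  gcongr

lemma integral_norm_sq_le_of_kernelLE {p : ℝ≥0∞} (hp : 2 < p)
    (hu : ContMDiff (𝓡∂ 2) 𝓘(ℝ, E n) 1 u) (hH : MemLp H p (area u))
    (hd : 0 < Metric.diam (Set.range u)) {δ : ℝ} (hδ : δ ≤ 1 / 2)
    (hsmall : constC p * (eLpNorm H p (area u)).toReal * Metric.diam (Set.range u) ^ expAlpha p
      ≤ δ) (hB : B ≤ 4 * Real.pi) {q₀ : M}
    (hkernel : KernelLE u (u q₀) (B + 1 / 8 * ∫ q, ‖H q‖ ^ 2 ∂area u)) :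
    1 / 8 * ∫ q, ‖H q‖ ^ 2 ∂area u ≤ 4 * δ ^ 2 := by
  have hsq := integral_norm_sq_le_of_small hp hu hH hd hsmall
  have harea := measureReal_area_div_le hu hd hkernel
  rw [mul_comm (2 : ℝ), ← div_div] at harea
  set a := (area u).real Set.univ / Metric.diam (Set.range u) ^ 2
  have hδ₀ : 0 ≤ δ := by
    have := one_le_constC hp
    exact hsmall.trans' (by positivity)
  have ha_le : a ≤ 31 := by
    have : δ ^ 2 * (1 + a) ≤ (1 / 2) ^ 2 * (1 + a) :=
      mul_le_mul_of_nonneg_right (by gcongr) (by positivity)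
    linarith [Real.pi_lt_d2]
  have : δ ^ 2 * (1 + a) ≤ δ ^ 2 * (1 + 31) := by gcongr
  linarith

end Embeddedness

end BranchedSurface

end

open BranchedSurface in
theorem corollary3p5_general {n : ℕ} {M : Type*} [TopologicalSpace M] [T2Space M] [CompactSpace M]
    [ChartedSpace (EuclideanHalfSpace 2) M] [IsManifold (𝓡∂ 2) 1 M] [MeasurableSpace M]
    [BorelSpace M] {γ : ℝ → E n} {u H : M → E n} {ε : ℝ} (hε₀ : 0 < ε) (hε₂ : ε ≤ 2)
    (hγ : IsC1ClosedCurve γ) (hT : totalCurvature γ ≤ ENNReal.ofReal ((4 - ε) * Real.pi))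
    (hu : IsBranchedImmersion u) (hinj : Set.InjOn u ((𝓡∂ 2).boundary M))
    (hΓ : boundaryCurve u = Set.range γ) (hnormal : ∀ᵐ q ∂area u, H q ∈ (tangentPlane u q)ᗮ)
    (hdiv : DivergenceIdentity u H) {p : ℝ≥0∞} (hp : 2 < p) (hH : MemLp H p (area u))
    (hsmall : constC p * (eLpNorm H p (area u)).toReal * Metric.diam (Set.range u) ^ expAlpha p
      ≤ ε / 4) : IsEmbedded u := by
  have := isFiniteMeasure_area hu.contMDiff
  have hfin : totalCurvature γ ≠ ⊤ := ne_top_of_le_ne_top ENNReal.ofReal_ne_top hT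
  have hTC : (totalCurvature γ).toReal ≤ (4 - ε) * Real.pi :=
    ENNReal.toReal_le_of_le_ofReal (mul_nonneg (by linarith) Real.pi_pos.le) hT
  have hεπ : ε < ε * Real.pi := lt_mul_of_one_lt_right hε₀ (by linarith [Real.pi_gt_three])
  have hH₂ : MemLp H 2 (area u) := hH.mono_exponent hp.le
  have hsub : Set.range γ ⊆ Set.range u := hΓ ▸ Set.image_subset_range _ _
  obtain ⟨q₀, -⟩ := hsub ⟨0, rfl⟩
  have energy_le : 1 / 8 * ∫ q, ‖H q‖ ^ 2 ∂area u ≤ 4 * (ε / 4) ^ 2 :=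
    integral_norm_sq_le_of_kernelLE hp hu.contMDiff hH
      (diam_range_pos hu.contMDiff.continuous hγ hsub) (by linarith) hsmall (by linarith)
      (kernelLE_totalCurvature_add hu hγ hfin hΓ hnormal hdiv hH₂ (u q₀))
  refine isEmbedded_of_totalCurvature_add_lt_four_pi hu hinj hγ hfin hΓ hnormal hdiv hH₂ ?_
  nlinarith

open BranchedSurface in
theorem corollary3p5 (ε : ℝ) (hε₀ : 0 < ε) (hε₂ : ε ≤ 2) :
    ∃ δ : ℝ, 0 < δ ∧ δ < 1 ∧
      ∀ (n : ℕ) (M : Type*) [TopologicalSpace M] [T2Space M] [CompactSpace M]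
        [ChartedSpace (EuclideanHalfSpace 2) M] [IsManifold (𝓡∂ 2) ∞ M]
        [MeasurableSpace M] [BorelSpace M]
        (γ : ℝ → E n) (u : M → E n) (H : M → E n) (p : ℝ≥0∞),
        IsC1ClosedCurve γ →
        totalCurvature γ ≤ ENNReal.ofReal ((4 - ε) * Real.pi) →
        IsBranchedImmersion u →
        Set.InjOn u ((𝓡∂ 2).boundary M) →
        boundaryCurve u = Set.range γ →
        IsMeanCurvature u H →
        DivergenceIdentity u H →
        2 < p →
        MemLp H p (area u) →
        constC p * (eLpNorm H p (area u)).toReal * Metric.diam (Set.range u) ^ expAlpha p < δ →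
        IsEmbedded u := by
  refine ⟨ε / 4, by linarith, by linarith, fun n M _ _ _ _ _ _ _ γ u H p => ?_⟩
  intro hγ hT hu hinj hΓ hH hdiv hp hHp hsmall
  have : IsManifold (𝓡∂ 2) 1 M := .of_le (n := ∞) (by norm_num)
  exact corollary3p5_general hε₀ hε₂ hγ hT hu hinj hΓ hH.normal hdiv hp hHp hsmall.le
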